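/- Let $d\ge 1$ be an integer, $0<s<d$ and $q>0$. Let $\sigma_d$ be the normalized surface area measure on the unit sphere $\mathbb S^d\subset\mathbb R^{d+1}$, write $U_s^{\mu}(x)=\int|x-y|^{-s}\,d\mu(y)$ for the Riesz $s$-potential of a (signed) measure $\mu$ on $\mathbb S^d$, and let $$W_s(\mathbb S^d)=\inf_\mu\iint|x-y|^{-s}\,d\mu(x)\,d\mu(y)$$ be the infimum over all Borel probability measures $\mu$ on $\mathbb S^d$. For $R>1$ let $a_R=(0,\dots,0,R)\in\mathbb R^{d+1}$, let $Q_R(x)=q/|x-a_R|^{s}$, and define the Gonchar function of the first kind $$\Gamma(R)=\Big(\frac{W_s(\mathbb S^d)}{q}(R-1)^d-(R+1)^{d-s}\Big)R^{d-1}+R^{d-1}(R-1)^d\,U_s^{\sigma_d}(a_R),\qquad R>1.$$ A signed $s$-equilibrium associated with $Q_R$ is a finite signed Borel measure $\eta$ on $\mathbb S^d$ with $\eta(\mathbb S^d)=1$, whose positive and negative parts have $s$-potentials that are finite everywhere on $\mathbb S^d$, and for which $U_s^{\eta}+Q_R$ is constant everywhere on $\mathbb S^d$. An $s$-extremal measure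 associated with $Q_R$ is a Borel probability measure on $\mathbb S^d$ minimizing $\iint|x-y|^{-s}\,d\mu(x)\,d\mu(y)+2\int Q_R\,d\mu$ among all Borel probability measures on $\mathbb S^d$. Then: 1. For every $R>1$ there is exactly one signed $s$-equilibrium $\eta_R$ on $\mathbb S^d$ associated with $Q_R$. 2. $\Gamma$ has exactly one zero $R_q$ in $(1,\infty)$. For every $R>1$, $\eta_R$ is a positive measure if and only if $R\ge R_q$; and if $R\ge R_q$, then moreover $\eta_R(V)>0$ for every nonempty open $V\subset\mathbb S^d$, so that $\eta_R$ is a positive measure on all of $\mathbb S^d$. 3. (Gonchar's problem.) The number $R_q-1$ is the smallest distance from an exterior point charge $q$ at $a_R$, $R>1$, to $\mathbb S^d$ for which there is an $s$-extremal measure associated with $Q_R$ whose support is all of $\mathbb S^d$. 4. If $s=d-1-2m$ for some integer $m\ge 0$, then $\Gamma$ coincides on $(1,\infty)$ with a polynomial in $R$ with real coefficients. -/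

import Mathlib

open MeasureTheory
open scoped ENNReal

noncomputable section

namespace Gonchar

/-- Euclidean space `ℝ^{d+1}`. -/
abbrev Space (d : ℕ) : Type := EuclideanSpace ℝ (Fin (d + 1))

/-- The unit sphere `𝕊^d` in `ℝ^{d+1}`. -/
abbrev Sph (d : ℕ) : Type := Metric.sphere (0 : Space d) 1

/-- The normalized surface area measure `σ_d` on `𝕊^d`. -/
def sigma (d : ℕ) : Measure (Sph d) :=
  ((volume : Measure (Space d)).toSphere Set.univ)⁻¹ • (volume : Measure (Space d)).toSphere

/-- The Riesz `s`-potential `U_s^μ(x) = ∫ |x - y|^{-s} dμ(y)` of a positive measure on `𝕊^d`,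
with values in `[0, ∞]` (the kernel is `∞` on the diagonal when `s > 0`). -/
def rieszPotential {d : ℕ} (s : ℝ) (μ : Measure (Sph d)) (x : Space d) : ℝ≥0∞ :=
  ∫⁻ y : Sph d, edist x (y : Space d) ^ (-s) ∂μ

/-- The Riesz `s`-energy `∫∫ |x - y|^{-s} dμ(y) dμ(x)`. -/
def rieszEnergy {d : ℕ} (s : ℝ) (μ : Measure (Sph d)) : ℝ≥0∞ :=
  ∫⁻ x : Sph d, rieszPotential s μ (x : Space d) ∂μ

/-- The `s`-energy `W_s(𝕊^d)`: the infimum of the energies of the Borel probability measures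
on the sphere. -/
def sphereEnergy (d : ℕ) (s : ℝ) : ℝ≥0∞ :=
  ⨅ μ : ProbabilityMeasure (Sph d), rieszEnergy s (μ : Measure (Sph d))

/-- The location `a = (0, …, 0, R)` of the point charge on the polar axis. -/
def source (d : ℕ) (R : ℝ) : Space d := EuclideanSpace.single (Fin.last d) R

/-- The external field `Q(x) = q / |x - a|^s` of a point charge `q` at `a = (0, …, 0, R)`. -/
def externalField (d : ℕ) (R q s : ℝ) (x : Space d) : ℝ :=
  q / ‖x - source d R‖ ^ s

/-- `η` is a signed `s`-equilibrium on `𝕊^d` associated with the field `Q`: it has total charge `1`,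
the potentials of its positive and negative parts are finite on the sphere, and the weighted
potential `U_s^η + Q`, where `U_s^η = U_s^{η⁺} - U_s^{η⁻}`, is constant everywhere on the sphere. -/
def IsSignedEquilibrium {d : ℕ} (s : ℝ) (Q : Space d → ℝ) (η : SignedMeasure (Sph d)) : Prop :=
  η Set.univ = 1 ∧
  (∀ x : Sph d, rieszPotential s η.toJordanDecomposition.posPart (x : Space d) ≠ ∞ ∧
    rieszPotential s η.toJordanDecomposition.negPart (x : Space d) ≠ ∞) ∧
  ∃ G : ℝ, ∀ x : Sph d,
    (rieszPotential s η.toJordanDecomposition.posPart (x : Space d)).toReal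
      - (rieszPotential s η.toJordanDecomposition.negPart (x : Space d)).toReal
      + Q (x : Space d) = G

/-- The weighted energy `I_Q[μ] = I_s[μ] + 2 ∫ Q dμ` (for a field `Q` continuous on the sphere). -/
def weightedEnergy {d : ℕ} (s : ℝ) (Q : Space d → ℝ) (μ : Measure (Sph d)) : EReal :=
  (rieszEnergy s μ : EReal) + ((2 * ∫ x : Sph d, Q (x : Space d) ∂μ : ℝ) : EReal)

/-- `μ` is an `s`-extremal (positive equilibrium) measure on `𝕊^d` associated with `Q`:
a Borel probability measure of minimal weighted energy. -/
def IsExtremal {d : ℕ} (s : ℝ) (Q : Space d → ℝ) (μ : ProbabilityMeasure (Sph d)) : Prop :=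
  weightedEnergy s Q (μ : Measure (Sph d)) =
    ⨅ ν : ProbabilityMeasure (Sph d), weightedEnergy s Q (ν : Measure (Sph d))

/-- `U_s^{σ_d}(R)`, the potential of `σ_d` at the point `(0, …, 0, R)`. -/
def sigmaPotential (d : ℕ) (s R : ℝ) : ℝ :=
  (rieszPotential s (sigma d) (source d R)).toReal

/-- The Gonchar function of the first kind (for `d ≥ 1` and `R > 1`). -/
def goncharA (d : ℕ) (s q R : ℝ) : ℝ :=
  ((sphereEnergy d s).toReal / q * (R - 1) ^ d - (R + 1) ^ ((d : ℝ) - s)) * R ^ (d - 1)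
    + R ^ (d - 1) * (R - 1) ^ d * sigmaPotential d s R

/-- The distances from the sphere to an exterior point charge `q` for which all of the sphere is
positively charged, i.e. for which the associated `s`-extremal measure has support `𝕊^d`. -/
def fullSupportDistances (d : ℕ) (s q : ℝ) : Set ℝ :=
  {ρ | ∃ R : ℝ, 1 < R ∧ ρ = Metric.infDist (source d R) (Metric.sphere (0 : Space d) 1) ∧
    ∃ μ : ProbabilityMeasure (Sph d), IsExtremal s (externalField d R q s) μ ∧
      (μ : Measure (Sph d)).support = Set.univ}

end Gonchar

end

/-!
The energy `W_s` of the sphere is attained by the surface measure `σ`, whose potential is constant on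
the sphere. Two facts give this: `σ` is rotation invariant, and the Riesz kernel is positive
semidefinite, being a mixture of products of Gaussians (`exists_edist_rpow_eq_lintegral_mul`,
`two_mul_mutualEnergy_le`).

The inversion about an exterior point `a`, of squared radius `|a|² - 1`, maps the sphere to itself.
Its homogeneous extension has Jacobian `λ^d`, with `λ` the conformal factor, so transporting the
identity `U_s^σ = W_s` by it shows that the density `(|a|² - 1)^{d-s} |y - a|^{s-2d} / W_s` has
potential `|x - a|^{-s}` on the sphere (`lintegral_edist_mul_kelvinDensity`), with total mass
`U_s^σ(a) / W_s` (`lintegral_kelvinDensity`). Hence a signed equilibrium is explicit: a uniform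
charge `1 + q U_s^σ(a) / W_s` minus `q` times that density (`isSignedEquilibrium_sub`).

A finite measure `ν` on the sphere is determined by the values of its potential `σ`-almost everywhere
(`measure_eq_of_rieszPotential_ae_eq`): integrating them against the Kelvin densities recovers the
potential at every exterior point, that is `∫ (A - ⟪x, u⟫)^{-s/2} dν(x)` for all `A > 1` and unit `u`;
differentiating in `A` and applying the Weierstrass theorem recovers the distribution of every
`⟪x, u⟫`, hence the characteristic function. This gives uniqueness of the signed equilibrium.

The density of the signed equilibrium is smallest at the north pole, and its value there has the sign
of the Gonchar function (`goncharA_nonneg_iff`). If it is nonnegative, the signed equilibrium is a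
probability measure of constant weighted potential, hence extremal by positive semidefiniteness.
Conversely, the weighted potential of an extremal measure of full support is at most a constant
everywhere by lower semicontinuity and at least that constant in `σ`-mean by minimality, so it is
constant almost everywhere and the measure is the signed equilibrium
(`goncharA_nonneg_of_isExtremal`).

The Gonchar function has the sign of `W_s / q - h(R)` with
`h(R) = (R + 1)^{d-s} / (R - 1)^d - U_s^σ(a_R)`. By the Kelvin transform `h` is the decreasing first
term times the mean of `1 - ((R - 1) / |y - a_R|)^{2d-s}`, which decreases in `R` as well
(`criticalRatio_eq`), so `h` takes the value `W_s / q` exactly once.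

For `s = d - 1` the Kelvin transform and differentiation in `R` give a first-order equation with
solution `U_s^σ(a_R) = R^{-(d-1)}`, and for `s = d - 1 - 2m` successive integration shows that
`R^{d-1} U_s^σ(a_R)` is a polynomial in `R²` of degree at most `m` (`exists_radialIntegral_eq_sum`).
-/

noncomputable section

namespace Gonchar

open EuclideanGeometry
open scoped Pointwise RealInnerProductSpace

/-! ### The sphere measure -/

instance isProbabilityMeasure_sigma (d : ℕ) : IsProbabilityMeasure (sigma d) := by
  refine ⟨?_⟩
  have h0 : (volume : Measure (Space d)).toSphere Set.univ ≠ 0 :=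
    Measure.measure_univ_ne_zero.2 (Measure.toSphere_ne_zero _)
  simp only [sigma, Measure.smul_apply, smul_eq_mul]
  exact ENNReal.inv_mul_cancel h0 (measure_ne_top _ _)

instance isOpenPosMeasure_sigma (d : ℕ) : (sigma d).IsOpenPosMeasure := by
  refine Measure.IsOpenPosMeasure.mk fun U hU hne => ?_
  simp only [sigma, Measure.smul_apply, smul_eq_mul]
  exact mul_ne_zero (ENNReal.inv_ne_zero.2 (measure_ne_top _ _)) (hU.measure_ne_zero _ hne)

/-- Integration in polar coordinates. -/
theorem lintegral_polar {d : ℕ} {f : Space d → ℝ≥0∞} (hf : Measurable f) :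
    ∫⁻ z, f z = ∫⁻ y : Sph d, (∫⁻ r in Set.Ioi (0 : ℝ),
      ENNReal.ofReal (r ^ d) * f (r • (y : Space d))) ∂(volume : Measure (Space d)).toSphere := by
  have hmp := (volume : Measure (Space d)).measurePreserving_homeomorphUnitSphereProd
  have hdim : Module.finrank ℝ (Space d) - 1 = d := by simp
  rw [hdim] at hmp
  have h1 : ∫⁻ z, f z = ∫⁻ z : ({(0 : Space d)}ᶜ : Set (Space d)), f z ∂(volume.comap Subtype.val) := by
    rw [lintegral_subtype_comap (measurableSet_singleton _).compl, restrict_compl_singleton]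
  have h2 := hmp.symm (homeomorphUnitSphereProd (Space d)).toMeasurableEquiv |>.lintegral_comp
    (f := fun z => f z) (by fun_prop)
  rw [h1]
  have h3 : ∫⁻ z : ({(0 : Space d)}ᶜ : Set (Space d)), f z ∂(volume.comap Subtype.val) =
    ∫⁻ p : Sph d × Set.Ioi (0 : ℝ), f ((p.2 : ℝ) • (p.1 : Space d))
      ∂((volume : Measure (Space d)).toSphere.prod (Measure.volumeIoiPow d)) := by
    rw [← h2]
    rfl
  rw [h3, lintegral_prod _ (by fun_prop)]
  refine lintegral_congr fun y => ?_
  have hm : Measurable fun r : Set.Ioi (0 : ℝ) => f ((r : ℝ) • (y : Space d)) := by fun_prop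
  rw [Measure.volumeIoiPow, lintegral_withDensity_eq_lintegral_mul _ (by fun_prop) hm]
  exact lintegral_subtype_comap measurableSet_Ioi
    (fun r : ℝ => ENNReal.ofReal (r ^ d) * f (r • (y : Space d)))


/-- The sphere integral of `g` is, up to a finite nonzero factor depending on `d` only, the volume
integral over the unit ball of the extension of `g` that is constant along rays. -/
theorem exists_lintegral_ball_eq (d : ℕ) : ∃ c : ℝ≥0∞, c ≠ 0 ∧ c ≠ ∞ ∧
    ∀ g : Space d → ℝ≥0∞, Measurable g →
      ∫⁻ z in Metric.ball (0 : Space d) 1, g (‖z‖⁻¹ • z) = c * ∫⁻ y : Sph d, g y ∂sigma d := by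
  set τ := (volume : Measure (Space d)).toSphere with hτ
  have hτ0 : τ Set.univ ≠ 0 := Measure.measure_univ_ne_zero.2 (Measure.toSphere_ne_zero _)
  set k : ℝ≥0∞ := ∫⁻ r in Set.Ioo (0 : ℝ) 1, ENNReal.ofReal (r ^ d) with hk
  have hk0 : k ≠ 0 := by
    have : 0 < k := by
      rw [hk, setLIntegral_pos_iff (by fun_prop)]
      have : Function.support (fun r : ℝ => ENNReal.ofReal (r ^ d)) ∩ Set.Ioo 0 1
          = Set.Ioo 0 1 := by
        refine Set.inter_eq_right.2 fun r hr => ?_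
        simpa using pow_pos hr.1 d
      rw [this]
      simp
    exact this.ne'
  have hk1 : k ≠ ∞ := by
    have : k ≤ ∫⁻ r in Set.Ioo (0 : ℝ) 1, 1 := by
      refine setLIntegral_mono (by fun_prop) fun r hr => ?_
      exact ENNReal.ofReal_le_one.2 (pow_le_one₀ hr.1.le hr.2.le)
    refine ne_top_of_le_ne_top ?_ this
    simp
  refine ⟨k * τ Set.univ, mul_ne_zero hk0 hτ0, ENNReal.mul_ne_top hk1 (measure_ne_top _ _),
    fun g hg => ?_⟩
  have hmg : Measurable fun z : Space d => g (‖z‖⁻¹ • z) := hg.comp (by fun_prop)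
  rw [← lintegral_indicator measurableSet_ball,
    lintegral_polar (hmg.indicator measurableSet_ball)]
  have h1 : ∀ y : Sph d, ∫⁻ r in Set.Ioi (0 : ℝ), ENNReal.ofReal (r ^ d) *
      (Metric.ball (0 : Space d) 1).indicator (fun z => g (‖z‖⁻¹ • z)) (r • (y : Space d))
      = k * g y := by
    intro y
    rw [hk, ← lintegral_mul_const _ (by fun_prop), ← lintegral_indicator measurableSet_Ioi,
      ← lintegral_indicator measurableSet_Ioo]
    refine lintegral_congr fun r => ?_
    have hy : ‖(y : Space d)‖ = 1 := by simp
    by_cases hr : 0 < r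
    · have hn : ‖r • (y : Space d)‖ = r := by rw [norm_smul, hy, mul_one, Real.norm_of_nonneg hr.le]
      by_cases hr1 : r < 1
      · simp [Set.indicator, hr, hr1, abs_of_pos hr, smul_smul, norm_smul, hr.ne']
      · simp [Set.indicator, hr, hr1, abs_of_pos hr, norm_smul]
    · simp [Set.indicator, hr]
  rw [lintegral_congr h1, lintegral_const_mul _ (by fun_prop), sigma, lintegral_smul_measure,
    smul_eq_mul, mul_assoc, ← mul_assoc (τ Set.univ), ENNReal.mul_inv_cancel hτ0 (measure_ne_top _ _),
    one_mul]

/-- Change of variables on the sphere: the sphere measure is transported by a norm-preserving map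
that is positively homogeneous of degree one through the Jacobian determinant of that map. -/
theorem lintegral_sigma_comp {d : ℕ} {ψ : Space d → Space d} {ψ' : Space d → Space d →L[ℝ] Space d}
    {J : Space d → ℝ≥0∞} (hom : ∀ z, z ≠ 0 → ψ z = ‖z‖ • ψ (‖z‖⁻¹ • z))
    (hnorm : ∀ z, ‖ψ z‖ = ‖z‖) (hinv : ∀ z, z ≠ 0 → ψ (ψ z) = z)
    (hder : ∀ z, z ≠ 0 → HasFDerivAt ψ (ψ' z) z)
    (hJ : ∀ z, z ≠ 0 → ENNReal.ofReal |(ψ' z).det| = J (‖z‖⁻¹ • z)) (hJm : Measurable J)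
    (hψm : Measurable ψ) {g : Space d → ℝ≥0∞} (hg : Measurable g) :
    ∫⁻ y : Sph d, g y ∂sigma d = ∫⁻ y : Sph d, J y * g (ψ y) ∂sigma d := by
  obtain ⟨c, hc0, hc1, hc⟩ := exists_lintegral_ball_eq d
  refine (ENNReal.mul_right_inj hc0 hc1).1 ?_
  rw [← hc g hg, ← hc (fun y => J y * g (ψ y)) (hJm.mul (hg.comp hψm))]
  set B : Set (Space d) := Metric.ball 0 1 \ {0} with hB
  have hBm : MeasurableSet B := measurableSet_ball.diff (measurableSet_singleton _)
  have hBae : (B : Set (Space d)) =ᵐ[volume] Metric.ball 0 1 :=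
    sdiff_null_ae_eq_self (measure_singleton _)
  have him : ψ '' B = B := by
    have hmaps : ∀ z ∈ B, ψ z ∈ B := by
      rintro z ⟨hz, hz0⟩
      refine ⟨by simpa [hnorm] using hz, ?_⟩
      simpa [← norm_eq_zero, hnorm] using hz0
    refine subset_antisymm (Set.image_subset_iff.2 hmaps) fun z hz => ?_
    exact ⟨ψ z, hmaps z hz, hinv z hz.2⟩
  have hinj : Set.InjOn ψ B := fun x hx y hy h => by
    rw [← hinv x hx.2, h, hinv y hy.2]
  rw [← setLIntegral_congr hBae, ← setLIntegral_congr hBae]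
  nth_rewrite 1 [← him]
  rw [lintegral_image_eq_lintegral_abs_det_fderiv_mul volume hBm
    (fun z hz => (hder z hz.2).hasFDerivWithinAt) hinj]
  refine setLIntegral_congr_fun hBm fun z hz => ?_
  have hz0 : z ≠ 0 := hz.2
  have hnz : ‖z‖ ≠ 0 := norm_ne_zero_iff.2 hz0
  simp only [hJ z hz0, hnorm]
  congr 2
  rw [hom z hz0, smul_smul, inv_mul_cancel₀ hnz, one_smul]

/-! ### Rotation invariance and finiteness of the potential -/

theorem lintegral_sigma_comp_reflection {d : ℕ} (K : Submodule ℝ (Space d))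
    {g : Space d → ℝ≥0∞} (hg : Measurable g) :
    ∫⁻ y : Sph d, g y ∂sigma d = ∫⁻ y : Sph d, g (K.reflection y) ∂sigma d := by
  have h := lintegral_sigma_comp (ψ := K.reflection)
    (ψ' := fun _ => (K.reflection : Space d →L[ℝ] Space d)) (J := fun _ => 1) (g := g)
    (fun z hz => ?_) (fun z => by simp) (fun z _ => by simp)
    (fun z _ => (K.reflection : Space d →L[ℝ] Space d).hasFDerivAt) (fun z _ => ?_)
    measurable_const K.reflection.continuous.measurable hg
  · simpa using h
  · rw [map_smul, smul_smul, mul_inv_cancel₀ (norm_ne_zero_iff.2 hz), one_smul]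
  · have : (K.reflection : Space d →L[ℝ] Space d).det = (-1) ^ Module.finrank ℝ Kᗮ :=
      K.det_reflection
    rw [this]
    simp

/-- The sphere measure is rotation invariant: the potential of any kernel depending on the distance
is constant on concentric spheres. -/
theorem lintegral_sigma_edist_eq {d : ℕ} {k : ℝ≥0∞ → ℝ≥0∞} (hk : Measurable k) {x x' : Space d}
    (h : ‖x‖ = ‖x'‖) :
    ∫⁻ y : Sph d, k (edist x y) ∂sigma d = ∫⁻ y : Sph d, k (edist x' y) ∂sigma d := by
  rw [lintegral_sigma_comp_reflection (Submodule.span ℝ {x - x'})ᗮ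
    (g := fun y => k (edist x' y)) (by fun_prop)]
  refine lintegral_congr fun y => ?_
  have h1 := LinearIsometryEquiv.edist_map (Submodule.span ℝ {x - x'})ᗮ.reflection x y
  rw [Submodule.reflection_sub h] at h1
  rw [h1]

theorem rieszPotential_sigma_eq {d : ℕ} (s : ℝ) {x x' : Space d} (h : ‖x‖ = ‖x'‖) :
    rieszPotential s (sigma d) x = rieszPotential s (sigma d) x' :=
  lintegral_sigma_edist_eq (k := fun t => t ^ (-s)) (by fun_prop) h

theorem sigma_singleton {d : ℕ} (hd : 1 ≤ d) (x : Sph d) : sigma d {x} = 0 := by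
  have h : (volume : Measure (Space d)).toSphere {x} = 0 := by
    rw [Measure.toSphere_apply' _ (measurableSet_singleton _)]
    have hne : Submodule.span ℝ {(x : Space d)} ≠ ⊤ := by
      intro h
      have h1 := finrank_span_le_card (R := ℝ) ({(x : Space d)} : Set (Space d))
      rw [h, finrank_top] at h1
      simp at h1
      omega
    have h0 := Measure.addHaar_submodule (volume : Measure (Space d)) _ hne
    have hsub : Set.Ioo (0 : ℝ) 1 • (Subtype.val '' ({x} : Set (Sph d)) : Set (Space d)) ⊆
        Submodule.span ℝ {(x : Space d)} := by
      rintro _ ⟨r, -, _, ⟨y, rfl, rfl⟩, rfl⟩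
      exact Submodule.smul_mem _ _ (Submodule.mem_span_singleton_self _)
    rw [measure_mono_null hsub h0, mul_zero]
  simp [sigma, h]

theorem edist_rpow_eq_ofReal {d : ℕ} {x y : Space d} (h : x ≠ y) (p : ℝ) :
    edist x y ^ p = ENNReal.ofReal (‖x - y‖ ^ p) := by
  rw [edist_dist, dist_eq_norm, ENNReal.ofReal_rpow_of_pos (norm_pos_iff.2 (sub_ne_zero.2 h))]

theorem lintegral_ball_edist_rpow_ne_top {d : ℕ} {p : ℝ} (hp : p < d + 1) (x : Space d) (r : ℝ) :
    ∫⁻ z in Metric.ball x r, edist x z ^ (-p) ≠ ∞ := by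
  have h1 : IntegrableOn (fun z : Space d => ‖z‖ ^ (-p)) (Metric.ball 0 r) := by
    rw [integrableOn_fun_norm_addHaar volume (f := fun t : ℝ => t ^ (-p))]
    have h2 : IntegrableOn (fun t : ℝ => t ^ ((d : ℝ) - p)) (Set.Ioo 0 r) := by
      rcases le_or_gt r 0 with hr | hr
      · simp [Set.Ioo_eq_empty_of_le hr]
      · rw [intervalIntegral.integrableOn_Ioo_rpow_iff hr]
        linarith
    refine h2.congr_fun (fun t ht => ?_) measurableSet_Ioo
    have : Module.finrank ℝ (Space d) - 1 = d := by simp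
    simp only [this, smul_eq_mul]
    rw [sub_eq_add_neg, Real.rpow_add ht.1, Real.rpow_natCast]
  have h3 := h1.lintegral_lt_top
  have h4 : ∫⁻ z in Metric.ball x r, edist x z ^ (-p) =
      ∫⁻ z in Metric.ball (0 : Space d) r, ENNReal.ofReal (‖z‖ ^ (-p)) := by
    rw [← lintegral_indicator measurableSet_ball, ← lintegral_indicator measurableSet_ball,
      ← lintegral_add_right_eq_self _ x]
    refine lintegral_congr_ae ?_
    have h0 : ∀ᵐ z : Space d, z ≠ 0 := Measure.ae_ne volume 0
    filter_upwards [h0] with z hz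
    have : x ≠ z + x := by simpa using hz
    simp [Set.indicator, edist_rpow_eq_ofReal this]
  rw [h4]
  exact h3.ne

theorem rieszPotential_sigma_ne_top_of_mem {d : ℕ} {s : ℝ} (hs : 0 < s) (hsd : s < d) (x : Sph d) :
    rieszPotential s (sigma d) x ≠ ∞ := by
  have hd : 1 ≤ d := by
    have : (0 : ℝ) < d := hs.trans hsd
    exact_mod_cast this
  set τ := (volume : Measure (Space d)).toSphere with hτ
  have hx : ‖(x : Space d)‖ = 1 := by simp
  set f : Space d → ℝ≥0∞ :=
    (Metric.ball (x : Space d) 8).indicator fun z => edist (x : Space d) z ^ (-(s + 1)) with hf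
  have hfm : Measurable f := Measurable.indicator (by fun_prop) measurableSet_ball
  have h1 : ∫⁻ z, f z ≠ ∞ := by
    rw [hf, lintegral_indicator measurableSet_ball]
    exact lintegral_ball_edist_rpow_ne_top (by linarith) _ _
  rw [lintegral_polar hfm] at h1
  have hne : ∀ᵐ y ∂sigma d, y ≠ x := by
    rw [ae_iff]
    simpa using sigma_singleton hd x
  have hc : sigma d = (τ Set.univ)⁻¹ • τ := rfl
  have hτ0 : τ Set.univ ≠ 0 := Measure.measure_univ_ne_zero.2 (Measure.toSphere_ne_zero _)
  set I : Sph d → ℝ≥0∞ := fun y => ∫⁻ r in Set.Ioi (0 : ℝ),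
      ENNReal.ofReal (r ^ d) * f (r • (y : Space d)) with hI
  have h2 : ∫⁻ y, I y ∂sigma d ≠ ∞ := by
    rw [hc, lintegral_smul_measure, smul_eq_mul]
    exact ENNReal.mul_ne_top (ENNReal.inv_ne_top.2 hτ0) h1
  have h3 : ∀ᵐ y : Sph d ∂sigma d,
      ENNReal.ofReal (2 ^ (-(s + 1))) * edist (x : Space d) (y : Space d) ^ (-s) ≤ I y := by
    filter_upwards [hne] with y hyx
    have hxy : (x : Space d) ≠ y := fun h => hyx (Subtype.ext h.symm)
    have hy : ‖(y : Space d)‖ = 1 := by simp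
    set t := ‖(x : Space d) - y‖ with ht
    have ht0 : 0 < t := norm_pos_iff.2 (sub_ne_zero.2 hxy)
    have ht2 : t ≤ 2 := (norm_sub_le _ _).trans (by rw [hx, hy]; norm_num)
    -- On the segment `1 < r < 1 + t` of the ray through `y` the distance to `x` is at most `2 t`.
    have h4 : ∫⁻ r in Set.Ioo 1 (1 + t), ENNReal.ofReal ((2 * t) ^ (-(s + 1))) ≤ I y := by
      refine le_trans ?_ (lintegral_mono_set (fun r (hr : r ∈ Set.Ioo 1 (1 + t)) =>
        (zero_lt_one.trans hr.1 : (0 : ℝ) < r)))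
      refine setLIntegral_mono_ae' measurableSet_Ioo ?_
      have h0 : ∀ᵐ r : ℝ, r • (y : Space d) ≠ x := by
        by_cases h : ∃ r : ℝ, r • (y : Space d) = x
        · obtain ⟨r₀, hr₀⟩ := h
          filter_upwards [Measure.ae_ne volume r₀] with r hr h
          rw [← hr₀] at h
          refine hr (smul_left_injective ℝ (?_ : (y : Space d) ≠ 0) h)
          exact norm_ne_zero_iff.1 (by rw [hy]; exact one_ne_zero)
        · filter_upwards with r hr using h ⟨r, hr⟩
      filter_upwards [h0] with r hr0 hr
      have hb : ‖(x : Space d) - r • (y : Space d)‖ ≤ 2 * t := by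
        have : (x : Space d) - r • (y : Space d) = (x - y) - (r - 1) • (y : Space d) := by
          rw [sub_smul, one_smul]; abel
        rw [this]
        refine (norm_sub_le _ _).trans ?_
        rw [norm_smul, hy, Real.norm_of_nonneg (by linarith [hr.1])]
        linarith [hr.2]
      have hb0 : 0 < ‖(x : Space d) - r • (y : Space d)‖ :=
        norm_pos_iff.2 (sub_ne_zero.2 hr0.symm)
      have hmem : r • (y : Space d) ∈ Metric.ball (x : Space d) 8 := by
        rw [mem_ball_iff_norm']
        linarith
      rw [hf, Set.indicator_of_mem hmem, edist_rpow_eq_ofReal hr0.symm]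
      calc ENNReal.ofReal ((2 * t) ^ (-(s + 1)))
          ≤ ENNReal.ofReal (‖(x : Space d) - r • (y : Space d)‖ ^ (-(s + 1))) :=
            ENNReal.ofReal_le_ofReal (Real.rpow_le_rpow_of_nonpos hb0 hb (by linarith))
        _ ≤ _ := le_mul_of_one_le_left' (ENNReal.one_le_ofReal.2 (one_le_pow₀ hr.1.le))
    refine le_trans (le_of_eq ?_) h4
    rw [setLIntegral_const, Real.volume_Ioo, edist_rpow_eq_ofReal hxy, ← ht,
      ← ENNReal.ofReal_mul (by positivity), ← ENNReal.ofReal_mul (by positivity),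
      Real.mul_rpow zero_le_two ht0.le, add_sub_cancel_left, mul_assoc, ← Real.rpow_add_one ht0.ne']
    congr 3
    ring_nf
  have h5 := ne_top_of_le_ne_top h2 (lintegral_mono_ae h3)
  rw [lintegral_const_mul _ (by fun_prop)] at h5
  intro htop
  rw [rieszPotential] at htop
  rw [htop] at h5
  refine h5 (ENNReal.mul_top ?_)
  simpa using Real.rpow_pos_of_pos zero_lt_two _

/-! ### The Kelvin transform -/

section Kelvin

/-- The power `ρ² = |a|² - 1` of the point `a` with respect to the unit sphere divided by `|y - a|²`:
the conformal factor at `y` of the inversion about `a` that preserves the sphere. -/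
def conformalFactor {d : ℕ} (a y : Space d) : ℝ := (‖a‖ ^ 2 - 1) / ‖y - a‖ ^ 2

/-- The inversion about `a` in the sphere of squared radius `|a|² - 1`, which preserves the unit
sphere. -/
def sphereInversion {d : ℕ} (a : Space d) : Space d → Space d :=
  inversion a (Real.sqrt (‖a‖ ^ 2 - 1))

/-- The positively homogeneous extension of the restriction of `sphereInversion a` to the sphere. -/
def homInversion {d : ℕ} (a z : Space d) : Space d := ‖z‖ • sphereInversion a (‖z‖⁻¹ • z)

variable {d : ℕ} {a y : Space d}

theorem norm_sub_pos_of_unit (ha : 1 < ‖a‖) (hy : ‖y‖ = 1) : 0 < ‖y - a‖ := by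
  refine norm_pos_iff.2 (sub_ne_zero.2 ?_)
  rintro rfl
  linarith

theorem conformalFactor_pos (ha : 1 < ‖a‖) (hy : ‖y‖ = 1) : 0 < conformalFactor a y := by
  have := norm_sub_pos_of_unit ha hy
  have : 0 < ‖a‖ ^ 2 - 1 := by nlinarith
  unfold conformalFactor
  positivity

theorem sphereInversion_eq (ha : 1 < ‖a‖) :
    sphereInversion a y = conformalFactor a y • (y - a) + a := by
  have : 0 ≤ ‖a‖ ^ 2 - 1 := by nlinarith
  rw [sphereInversion, inversion, conformalFactor, div_pow, Real.sq_sqrt this, dist_eq_norm]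
  rfl

/-- On the sphere, the inversion about `a` acts as the reflection in the hyperplane orthogonal to
`y - a`, which is also the orthogonal part of its derivative at `y`. -/
theorem sphereInversion_eq_reflection (ha : 1 < ‖a‖) (hy : ‖y‖ = 1) :
    sphereInversion a y = (Submodule.span ℝ {y - a})ᗮ.reflection y := by
  have hpos := norm_sub_pos_of_unit ha hy
  have h1 : ‖y - a‖ ^ 2 = 1 - 2 * ⟪y, a⟫ + ‖a‖ ^ 2 := by
    rw [@norm_sub_sq_real, hy]; ring
  have h2 : ⟪y - a, y⟫ = 1 - ⟪y, a⟫ := by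
    rw [inner_sub_left, real_inner_self_eq_norm_sq, hy, real_inner_comm]; ring
  have h3 : conformalFactor a y = 1 - 2 * (⟪y - a, y⟫ / ‖y - a‖ ^ 2) := by
    rw [conformalFactor, h2]
    field_simp
    rw [h1]; ring
  rw [sphereInversion_eq ha, Submodule.reflection_orthogonal_apply,
    Submodule.reflection_singleton_apply, h3]
  simp only [RCLike.ofReal_real_eq_id, id]
  module

theorem norm_sphereInversion (ha : 1 < ‖a‖) (hy : ‖y‖ = 1) : ‖sphereInversion a y‖ = 1 := by
  rw [sphereInversion_eq_reflection ha hy, LinearIsometryEquiv.norm_map, hy]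

theorem norm_normalize {z : Space d} (hz : z ≠ 0) : ‖‖z‖⁻¹ • z‖ = 1 := by
  rw [norm_smul, norm_inv, norm_norm, inv_mul_cancel₀ (norm_ne_zero_iff.2 hz)]

theorem homInversion_of_unit (hy : ‖y‖ = 1) : homInversion a y = sphereInversion a y := by
  simp [homInversion, hy]

theorem norm_homInversion (ha : 1 < ‖a‖) (z : Space d) : ‖homInversion a z‖ = ‖z‖ := by
  rcases eq_or_ne z 0 with rfl | hz
  · simp [homInversion]
  · rw [homInversion, norm_smul, norm_sphereInversion ha (norm_normalize hz), norm_norm, mul_one]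

theorem homInversion_homInversion (ha : 1 < ‖a‖) {z : Space d} (hz : z ≠ 0) :
    homInversion a (homInversion a z) = z := by
  have hn : ‖z‖ ≠ 0 := norm_ne_zero_iff.2 hz
  have hr : Real.sqrt (‖a‖ ^ 2 - 1) ≠ 0 := (Real.sqrt_pos.2 (by nlinarith)).ne'
  conv_lhs => rw [homInversion, norm_homInversion ha]
  have h : homInversion a z = ‖z‖ • sphereInversion a (‖z‖⁻¹ • z) := rfl
  rw [h, smul_smul, inv_mul_cancel₀ hn, one_smul, sphereInversion, inversion_inversion _ hr, smul_smul,
    mul_inv_cancel₀ hn, one_smul]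

/-- The derivative of `homInversion a` at any point of the ray through the unit vector `y`: the
reflection in the hyperplane orthogonal to `y - a`, after the map that fixes `y` and scales the
tangent space of the sphere at `y` by the conformal factor. -/
def homInversionDeriv (a y : Space d) : Space d →L[ℝ] Space d :=
  ((Submodule.span ℝ {y - a})ᗮ.reflection : Space d →L[ℝ] Space d).comp
    (conformalFactor a y • ContinuousLinearMap.id ℝ (Space d) +
      (1 - conformalFactor a y) • (innerSL ℝ y).smulRight y)

theorem hasFDerivAt_homInversion (ha : 1 < ‖a‖) {z : Space d} (hz : z ≠ 0) :
    HasFDerivAt (homInversion a) (homInversionDeriv a (‖z‖⁻¹ • z)) z := by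
  set y := ‖z‖⁻¹ • z with hy
  have hn : ‖z‖ ≠ 0 := norm_ne_zero_iff.2 hz
  have hy1 : ‖y‖ = 1 := norm_normalize hz
  have hya : y ≠ a := by rintro h; rw [h] at hy1; linarith
  have hzy : z = ‖z‖ • y := by rw [hy, smul_smul, mul_inv_cancel₀ hn, one_smul]
  have h1 : HasFDerivAt (fun w : Space d => ‖w‖) (innerSL ℝ y) z := by
    have h := (hasStrictFDerivAt_norm_sq z).hasFDerivAt.sqrt (by positivity)
    simp only [Real.sqrt_sq (norm_nonneg _)] at h
    refine h.congr_fderiv ?_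
    ext v
    simp [hy]
    field_simp
  have h2 : HasFDerivAt (fun w : Space d => ‖w‖⁻¹ • w) _ z :=
    ((hasDerivAt_inv hn).comp_hasFDerivAt z h1).smul (hasFDerivAt_id z)
  have h3 : HasFDerivAt (sphereInversion a) _ y := hasFDerivAt_inversion hya
  have h4 := h1.smul (h3.comp z h2)
  refine h4.congr_fderiv ?_
  have hρ : (Real.sqrt (‖a‖ ^ 2 - 1) / dist y a) ^ 2 = conformalFactor a y := by
    rw [conformalFactor, div_pow, Real.sq_sqrt (by nlinarith), dist_eq_norm]
  ext1 v
  rw [hρ]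
  simp only [homInversionDeriv, Function.comp_apply, ← hy, sphereInversion_eq_reflection ha hy1]
  simp only [add_apply, smul_apply,
    ContinuousLinearMap.comp_apply, ContinuousLinearMap.smulRight_apply, innerSL_apply_apply,
    ContinuousLinearMap.id_apply, ContinuousLinearEquiv.coe_coe,
    map_add, map_smul, smul_eq_mul]
  have hL : ∀ w : Space d, ((Submodule.span ℝ {y - a})ᗮ.reflection : Space d ≃L[ℝ] Space d) w =
    (Submodule.span ℝ {y - a})ᗮ.reflection w := fun _ => rfl
  have hLz : (Submodule.span ℝ {y - a})ᗮ.reflection z =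
      ‖z‖ • (Submodule.span ℝ {y - a})ᗮ.reflection y := by
    rw [← map_smul, ← hzy]
  rw [hL, hL, hL, hLz]
  match_scalars <;> field_simp
  ring

theorem abs_det_homInversionDeriv (ha : 1 < ‖a‖) (hy : ‖y‖ = 1) :
    |(homInversionDeriv a y).det| = conformalFactor a y ^ d := by
  have hc := conformalFactor_pos ha hy
  set c := conformalFactor a y with hcdef
  have h1 : ((homInversionDeriv a y : Space d →L[ℝ] Space d) : Space d →ₗ[ℝ] Space d) =
      (Submodule.span ℝ {y - a})ᗮ.reflection.toLinearMap ∘ₗ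
        (c • LinearMap.transvection (((1 - c) / c) • (innerₗ (Space d) y)) y) := by
    ext1 v
    simp [homInversionDeriv, LinearMap.transvection, ← hcdef]
    rw [smul_smul, smul_smul, ← mul_assoc, mul_div_cancel₀ _ hc.ne']
  have h2 : (homInversionDeriv a y).det = LinearMap.det (_ : Space d →ₗ[ℝ] Space d) :=
    congrArg LinearMap.det h1
  rw [h2, LinearMap.det_comp, Submodule.det_reflection, LinearMap.det_smul,
    LinearMap.transvection.det]
  simp [abs_mul, hy, abs_of_pos hc]
  have h3 : 1 + (1 - c) / c = c⁻¹ := by field_simp; ring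
  rw [h3, abs_of_pos (inv_pos.2 hc), pow_succ, mul_assoc, mul_inv_cancel₀ hc.ne', mul_one]

theorem measurable_homInversion (a : Space d) : Measurable (homInversion a) := by
  unfold homInversion sphereInversion inversion
  simp only [vsub_eq_sub, vadd_eq_add]
  fun_prop

/-- The conformal image of the sphere measure under the inversion about `a`. -/
theorem lintegral_sigma_comp_sphereInversion (ha : 1 < ‖a‖) {g : Space d → ℝ≥0∞}
    (hg : Measurable g) :
    ∫⁻ y : Sph d, g y ∂sigma d =
      ∫⁻ y : Sph d, ENNReal.ofReal (conformalFactor a (y : Space d) ^ d) *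
        g (sphereInversion a y) ∂sigma d := by
  rw [lintegral_sigma_comp (ψ := homInversion a) (ψ' := fun z => homInversionDeriv a (‖z‖⁻¹ • z))
    (J := fun y => ENNReal.ofReal (conformalFactor a y ^ d)) (fun z hz => ?_)
    (norm_homInversion ha) (fun z => homInversion_homInversion ha)
    (fun z => hasFDerivAt_homInversion ha)
    (fun z hz => by rw [abs_det_homInversionDeriv ha (norm_normalize hz)])
    (by unfold conformalFactor; fun_prop) (measurable_homInversion a) hg]
  · refine lintegral_congr fun y => ?_
    rw [homInversion_of_unit (by simp)]
  · rw [homInversion_of_unit (norm_normalize hz), homInversion]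

/-- The density, relative to the sphere measure, of the measure on the sphere whose `s`-potential is
proportional on the sphere to that of the unit charge at `a`. -/
def kelvinDensity (d : ℕ) (s : ℝ) (a y : Space d) : ℝ :=
  (‖a‖ ^ 2 - 1) ^ (d - s) * ‖y - a‖ ^ (s - 2 * d)

theorem kelvinDensity_eq (s : ℝ) (ha : 1 < ‖a‖) (hy : ‖y‖ = 1) : kelvinDensity d s a y =
    conformalFactor a y ^ d * ((‖a‖ ^ 2 - 1) / ‖y - a‖) ^ (-s) := by
  have hya := norm_sub_pos_of_unit ha hy
  have hρ : 0 < ‖a‖ ^ 2 - 1 := by nlinarith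
  rw [kelvinDensity, conformalFactor]
  generalize ‖a‖ ^ 2 - 1 = ρ at *
  generalize ‖y - a‖ = b at *
  rw [div_pow, Real.div_rpow hρ.le hya.le, sub_eq_add_neg, Real.rpow_add hρ, Real.rpow_natCast,
    sub_eq_add_neg, Real.rpow_add hya, Real.rpow_neg hya.le, Real.rpow_neg hya.le, ← pow_mul,
    ← Real.rpow_natCast b (2 * d)]
  push_cast
  field_simp

theorem edist_sphereInversion (ha : 1 < ‖a‖) {x : Space d} (hx : ‖x‖ = 1) (hy : ‖y‖ = 1) :
    edist (sphereInversion a x) (sphereInversion a y) =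
      ENNReal.ofReal ((‖a‖ ^ 2 - 1) / (‖x - a‖ * ‖y - a‖)) * edist x y := by
  have h1 : x ≠ a := sub_ne_zero.1 (norm_pos_iff.1 (norm_sub_pos_of_unit ha hx))
  have h2 : y ≠ a := sub_ne_zero.1 (norm_pos_iff.1 (norm_sub_pos_of_unit ha hy))
  rw [edist_dist, edist_dist, ← ENNReal.ofReal_mul' dist_nonneg, sphereInversion,
    dist_inversion_inversion h1 h2, Real.sq_sqrt (by nlinarith), dist_eq_norm x a,
    dist_eq_norm y a]

/-- Kelvin transform of the potential of the sphere measure. -/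
theorem lintegral_edist_mul_kelvinDensity (s : ℝ) (ha : 1 < ‖a‖) {x : Space d} (hx : ‖x‖ = 1) :
    ∫⁻ y : Sph d, edist x (y : Space d) ^ (-s) * ENNReal.ofReal (kelvinDensity d s a y) ∂sigma d =
      ENNReal.ofReal (‖x - a‖ ^ (-s)) * rieszPotential s (sigma d) x := by
  have hxa := norm_sub_pos_of_unit ha hx
  have hρ : 0 < ‖a‖ ^ 2 - 1 := by nlinarith
  have h1 : rieszPotential s (sigma d) x = rieszPotential s (sigma d) (sphereInversion a x) :=
    rieszPotential_sigma_eq s (by rw [hx, norm_sphereInversion ha hx])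
  rw [h1, rieszPotential, lintegral_sigma_comp_sphereInversion ha
    (g := fun y => edist (sphereInversion a x) y ^ (-s)) (by fun_prop),
    ← lintegral_const_mul' _ _ ENNReal.ofReal_ne_top]
  refine lintegral_congr fun y => ?_
  have hy : ‖(y : Space d)‖ = 1 := by simp
  have hya := norm_sub_pos_of_unit ha hy
  have hq : 0 < (‖a‖ ^ 2 - 1) / (‖x - a‖ * ‖(y : Space d) - a‖) := by positivity
  rw [edist_sphereInversion ha hx hy, ENNReal.mul_rpow_of_ne_top ENNReal.ofReal_ne_top
    (edist_ne_top _ _), ENNReal.ofReal_rpow_of_pos hq, ← mul_assoc, ← mul_assoc,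
    ← ENNReal.ofReal_mul (by positivity), ← ENNReal.ofReal_mul (by
      have := conformalFactor_pos ha hy
      positivity), mul_comm (edist _ _ ^ _)]
  congr 2
  have := Real.rpow_pos_of_pos hxa (-s)
  rw [kelvinDensity_eq s ha hy, mul_comm ‖x - a‖, ← div_div,
    Real.div_rpow (by positivity) hxa.le]
  field_simp

/-- The total mass of the Kelvin transform is the potential of the sphere measure at `a`. -/
theorem lintegral_kelvinDensity (s : ℝ) (ha : 1 < ‖a‖) :
    ∫⁻ y : Sph d, ENNReal.ofReal (kelvinDensity d s a y) ∂sigma d =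
      rieszPotential s (sigma d) a := by
  have hρ : 0 < ‖a‖ ^ 2 - 1 := by nlinarith
  rw [rieszPotential, lintegral_sigma_comp_sphereInversion ha
    (g := fun y => edist a y ^ (-s)) (by fun_prop)]
  refine lintegral_congr fun y => ?_
  have hy : ‖(y : Space d)‖ = 1 := by simp
  have hya := norm_sub_pos_of_unit ha hy
  have hq : 0 < (‖a‖ ^ 2 - 1) / ‖(y : Space d) - a‖ := by positivity
  have h1 : edist a (sphereInversion a y) =
      ENNReal.ofReal ((‖a‖ ^ 2 - 1) / ‖(y : Space d) - a‖) := by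
    rw [edist_dist, dist_comm, sphereInversion, dist_inversion_center, Real.sq_sqrt hρ.le,
      dist_eq_norm]
  have hc := conformalFactor_pos ha hy
  rw [h1, ENNReal.ofReal_rpow_of_pos hq, ← ENNReal.ofReal_mul (by positivity)]
  rw [kelvinDensity_eq s ha hy]

end Kelvin

/-! ### Positive semidefiniteness of the Riesz kernel -/

/-- The mutual energy `∫∫ |x - y|^{-s} dμ(y) dν(x)` of two measures on the sphere. -/
def mutualEnergy {d : ℕ} (s : ℝ) (μ ν : Measure (Sph d)) : ℝ≥0∞ :=
  ∫⁻ x : Sph d, rieszPotential s μ (x : Space d) ∂ν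

theorem mutualEnergy_self {d : ℕ} (s : ℝ) (μ : Measure (Sph d)) :
    mutualEnergy s μ μ = rieszEnergy s μ := rfl

theorem lintegral_gaussian_mul_gaussian {d : ℕ} {t : ℝ} (ht : 0 < t) (x y : Space d) :
    ∫⁻ z : Space d, ENNReal.ofReal (Real.exp (-(2 * t) * ‖x - z‖ ^ 2)) *
      ENNReal.ofReal (Real.exp (-(2 * t) * ‖y - z‖ ^ 2)) =
    ENNReal.ofReal ((Real.pi / (4 * t)) ^ (((d : ℝ) + 1) / 2)) *
      ENNReal.ofReal (Real.exp (-t * ‖x - y‖ ^ 2)) := by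
  have h4 : 0 < 4 * t := by positivity
  have hint := GaussianFourier.integral_rexp_neg_mul_sq_norm (V := Space d) h4
  have hfin : (Module.finrank ℝ (Space d) : ℝ) = (d : ℝ) + 1 := by simp
  rw [hfin] at hint
  have hpos : 0 < (Real.pi / (4 * t)) ^ (((d : ℝ) + 1) / 2) := by positivity
  have hi : Integrable fun z : Space d => Real.exp (-(4 * t) * ‖z‖ ^ 2) := by
    by_contra h
    rw [integral_undef h] at hint
    exact hpos.ne hint
  have hl : ∫⁻ z : Space d, ENNReal.ofReal (Real.exp (-(4 * t) * ‖z‖ ^ 2)) =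
      ENNReal.ofReal ((Real.pi / (4 * t)) ^ (((d : ℝ) + 1) / 2)) := by
    rw [← hint, ofReal_integral_eq_lintegral_ofReal hi
      (Filter.Eventually.of_forall fun _ => (Real.exp_pos _).le)]
  rw [← hl, ← lintegral_mul_const _ (by fun_prop),
    ← lintegral_add_right_eq_self _ ((1 / 2 : ℝ) • (x + y))]
  refine lintegral_congr fun z => ?_
  rw [← ENNReal.ofReal_mul (Real.exp_pos _).le, ← ENNReal.ofReal_mul (Real.exp_pos _).le,
    ← Real.exp_add, ← Real.exp_add]
  congr 2
  have h1 : x - (z + (1 / 2 : ℝ) • (x + y)) = (1 / 2 : ℝ) • (x - y) - z := by module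
  have h2 : y - (z + (1 / 2 : ℝ) • (x + y)) = -((1 / 2 : ℝ) • (x - y) + z) := by module
  have h3 := parallelogram_law_with_norm ℝ ((1 / 2 : ℝ) • (x - y)) z
  have h4 : ‖(1 / 2 : ℝ) • (x - y)‖ = 1 / 2 * ‖x - y‖ := by
    rw [norm_smul]; norm_num
  rw [h4] at h3
  rw [h1, h2, norm_neg]
  linear_combination (-(2 * t)) * h3

theorem lintegral_rpow_mul_exp_neg {a r : ℝ} (ha : 0 < a) (hr : 0 < r) :
    ∫⁻ t in Set.Ioi (0 : ℝ), ENNReal.ofReal (t ^ (a - 1) * Real.exp (-(r * t))) =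
      ENNReal.ofReal ((1 / r) ^ a * Real.Gamma a) := by
  have h := Real.integral_rpow_mul_exp_neg_mul_Ioi ha hr
  have hpos : 0 < (1 / r) ^ a * Real.Gamma a := by
    have := Real.Gamma_pos_of_pos ha
    positivity
  have hi : IntegrableOn (fun t : ℝ => t ^ (a - 1) * Real.exp (-(r * t))) (Set.Ioi 0) := by
    by_contra hn
    rw [integral_undef hn] at h
    exact hpos.ne h
  rw [← h, ofReal_integral_eq_lintegral_ofReal hi]
  filter_upwards [ae_restrict_mem measurableSet_Ioi] with t ht
  have := Real.rpow_nonneg (le_of_lt ht) (a - 1)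
  positivity

theorem lintegral_rpow_Ioi_eq_top (p : ℝ) :
    ∫⁻ t in Set.Ioi (0 : ℝ), ENNReal.ofReal (t ^ p) = ∞ := by
  by_contra h
  refine not_integrableOn_Ioi_rpow p ⟨by fun_prop, ?_⟩
  rw [hasFiniteIntegral_iff_ofReal]
  · exact lt_top_iff_ne_top.2 h
  · filter_upwards [ae_restrict_mem measurableSet_Ioi] with t ht
    exact Real.rpow_nonneg (le_of_lt ht) p

/-- The Riesz kernel is a mixture of products of Gaussians. -/
theorem exists_edist_rpow_eq_lintegral_mul (d : ℕ) {s : ℝ} (hs : 0 < s) :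
    ∃ (w : ℝ × Space d → ℝ≥0∞) (h : ℝ × Space d → Space d → ℝ≥0∞), Measurable w ∧
      Measurable (Function.uncurry h) ∧ ∀ x y : Space d, edist x y ^ (-s) =
        ∫⁻ ω, w ω * (h ω x * h ω y) ∂((volume.restrict (Set.Ioi (0 : ℝ))).prod volume) := by
  set G : ℝ → ℝ≥0∞ := fun t => ENNReal.ofReal ((Real.pi / (4 * t)) ^ (((d : ℝ) + 1) / 2)) with hG
  set c : ℝ≥0∞ := ENNReal.ofReal (Real.Gamma (s / 2)) with hc
  have hΓ : 0 < Real.Gamma (s / 2) := Real.Gamma_pos_of_pos (by positivity)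
  have hc0 : c ≠ 0 := by simpa [hc] using hΓ
  refine ⟨fun ω => c⁻¹ * (ENNReal.ofReal (ω.1 ^ (s / 2 - 1)) * (G ω.1)⁻¹),
    fun ω x => ENNReal.ofReal (Real.exp (-(2 * ω.1) * ‖x - ω.2‖ ^ 2)), by fun_prop,
    by simp only [Function.uncurry_def]; fun_prop, fun x y => ?_⟩
  rw [lintegral_prod _ (by fun_prop)]
  have h1 : ∀ t ∈ Set.Ioi (0 : ℝ), ∫⁻ z : Space d, c⁻¹ * (ENNReal.ofReal (t ^ (s / 2 - 1)) *
      (G t)⁻¹) * (ENNReal.ofReal (Real.exp (-(2 * t) * ‖x - z‖ ^ 2)) *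
        ENNReal.ofReal (Real.exp (-(2 * t) * ‖y - z‖ ^ 2))) =
      c⁻¹ * ENNReal.ofReal (t ^ (s / 2 - 1) * Real.exp (-(‖x - y‖ ^ 2 * t))) := by
    intro t ht
    have ht : 0 < t := ht
    have hG0 : G t ≠ 0 := by
      have : 0 < (Real.pi / (4 * t)) ^ (((d : ℝ) + 1) / 2) := by positivity
      simpa [hG] using this
    rw [lintegral_const_mul _ (by fun_prop), lintegral_gaussian_mul_gaussian ht,
      ENNReal.ofReal_mul (by positivity), mul_assoc, mul_assoc, ← mul_assoc (G t)⁻¹,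
      ENNReal.inv_mul_cancel hG0 ENNReal.ofReal_ne_top, one_mul]
    congr 5
    ring
  rw [setLIntegral_congr_fun measurableSet_Ioi h1, lintegral_const_mul _ (by fun_prop)]
  rcases eq_or_ne x y with rfl | hxy
  · have h0 : (0 : ℝ≥0∞) ^ (-s) = ∞ := ENNReal.zero_rpow_of_neg (by linarith)
    have h2 := lintegral_rpow_Ioi_eq_top (s / 2 - 1)
    simp [h0, h2, hc, ENNReal.mul_top]
  · have hr : 0 < ‖x - y‖ := norm_pos_iff.2 (sub_ne_zero.2 hxy)
    rw [lintegral_rpow_mul_exp_neg (by positivity) (by positivity), ENNReal.ofReal_mul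
      (by positivity), mul_left_comm, ← hc, ENNReal.inv_mul_cancel hc0 ENNReal.ofReal_ne_top,
      mul_one, edist_rpow_eq_ofReal hxy]
    congr 1
    rw [one_div, Real.inv_rpow (by positivity), ← Real.rpow_natCast, ← Real.rpow_mul hr.le,
      Real.rpow_neg hr.le]
    congr 2
    push_cast
    ring

theorem two_mul_le_add_sq_ennreal (a b : ℝ≥0∞) : 2 * (a * b) ≤ a * a + b * b := by
  rcases eq_or_ne a ∞ with rfl | ha
  · simp
  rcases eq_or_ne b ∞ with rfl | hb
  · simp
  lift a to NNReal using ha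
  lift b to NNReal using hb
  norm_cast
  have := two_mul_le_add_sq (a : ℝ) b
  rw [← NNReal.coe_le_coe]
  push_cast
  linarith

/-- Positive semidefiniteness of the Riesz kernel. -/
theorem two_mul_mutualEnergy_le {d : ℕ} {s : ℝ} (hs : 0 < s) (μ ν : Measure (Sph d))
    [IsFiniteMeasure μ] [IsFiniteMeasure ν] :
    2 * mutualEnergy s μ ν ≤ rieszEnergy s μ + rieszEnergy s ν := by
  obtain ⟨w, h, hw, hh, hk⟩ := exists_edist_rpow_eq_lintegral_mul d hs
  set m := (volume.restrict (Set.Ioi (0 : ℝ))).prod (volume : Measure (Space d)) with hm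
  set H : Measure (Sph d) → ℝ × Space d → ℝ≥0∞ := fun ρ ω => ∫⁻ x : Sph d, h ω x ∂ρ with hH
  have hmeas : Measurable fun p : (ℝ × Space d) × Sph d => h p.1 p.2 :=
    hh.comp (f := fun p : (ℝ × Space d) × Sph d => (p.1, (p.2 : Space d))) (by fun_prop)
  have hHm : ∀ ρ : Measure (Sph d), IsFiniteMeasure ρ → Measurable (H ρ) := fun ρ _ =>
    hmeas.lintegral_prod_right'
  have key : ∀ α β : Measure (Sph d), IsFiniteMeasure α → IsFiniteMeasure β →
      mutualEnergy s α β = ∫⁻ ω, w ω * (H α ω * H β ω) ∂m := by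
    intro α β _ _
    have hα := hHm α inferInstance
    have e1 : ∀ x : Sph d, rieszPotential s α x = ∫⁻ ω, w ω * (h ω x * H α ω) ∂m := by
      intro x
      simp only [rieszPotential, hk]
      rw [lintegral_lintegral_swap]
      · refine lintegral_congr fun ω => ?_
        have : Measurable fun y : Sph d => h ω y := hmeas.comp measurable_prodMk_left
        rw [lintegral_const_mul _ (by fun_prop), lintegral_const_mul _ this]
      · refine Measurable.aemeasurable ?_
        refine (hw.comp measurable_snd).mul (Measurable.mul ?_ ?_)
        · exact hmeas.comp (f := fun p : Sph d × ℝ × Space d => (p.2, x)) (by fun_prop)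
        · exact hmeas.comp (f := fun p : Sph d × ℝ × Space d => (p.2, p.1)) (by fun_prop)
    simp only [mutualEnergy, e1]
    rw [lintegral_lintegral_swap]
    · refine lintegral_congr fun ω => ?_
      have : Measurable fun y : Sph d => h ω y := hmeas.comp measurable_prodMk_left
      rw [lintegral_const_mul _ (by fun_prop), lintegral_mul_const _ this, mul_comm (H α ω)]
    · refine Measurable.aemeasurable ?_
      refine (hw.comp measurable_snd).mul (Measurable.mul ?_ (hα.comp measurable_snd))
      exact hmeas.comp (f := fun p : Sph d × ℝ × Space d => (p.2, p.1)) (by fun_prop)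
  have hμ := hHm μ inferInstance
  have hν := hHm ν inferInstance
  rw [← mutualEnergy_self, ← mutualEnergy_self, key _ _ inferInstance inferInstance,
    key _ _ inferInstance inferInstance, key _ _ inferInstance inferInstance,
    ← lintegral_add_left (by fun_prop), ← lintegral_const_mul _ (by fun_prop)]
  refine lintegral_mono fun ω => ?_
  rw [mul_left_comm, ← mul_add]
  gcongr
  exact two_mul_le_add_sq_ennreal _ _

theorem measurable_rieszPotential {d : ℕ} (s : ℝ) (μ : Measure (Sph d)) [IsFiniteMeasure μ] :
    Measurable fun x : Sph d => rieszPotential s μ (x : Space d) := by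
  unfold rieszPotential
  exact Measurable.lintegral_prod_right' (f := fun p : Sph d × Sph d =>
    edist (p.1 : Space d) (p.2 : Space d) ^ (-s)) (by fun_prop)

theorem mutualEnergy_comm {d : ℕ} (s : ℝ) (μ ν : Measure (Sph d))
    [IsFiniteMeasure μ] [IsFiniteMeasure ν] : mutualEnergy s μ ν = mutualEnergy s ν μ := by
  unfold mutualEnergy rieszPotential
  rw [lintegral_lintegral_swap (by fun_prop)]
  simp only [edist_comm]

/-! ### Equilibrium on the sphere -/

theorem nonempty_sphere (d : ℕ) : Nonempty (Sph d) :=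
  ⟨⟨EuclideanSpace.single (Fin.last d) 1, by simp⟩⟩

theorem mutualEnergy_of_rieszPotential_eq {d : ℕ} {s : ℝ} {μ : Measure (Sph d)} {c : ℝ≥0∞}
    (h : ∀ x : Sph d, rieszPotential s μ x = c) (ν : Measure (Sph d)) [IsProbabilityMeasure ν] :
    mutualEnergy s μ ν = c := by
  simp [mutualEnergy, h]

/-- The normalized surface measure minimizes the energy, and its potential is constant. -/
theorem rieszPotential_sigma_eq_sphereEnergy {d : ℕ} {s : ℝ} (hs : 0 < s) (hsd : s < d)
    (x : Sph d) : rieszPotential s (sigma d) x = sphereEnergy d s := by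
  have hconst : ∀ y : Sph d, rieszPotential s (sigma d) y = rieszPotential s (sigma d) x :=
    fun y => rieszPotential_sigma_eq s (by simp)
  have hfin := rieszPotential_sigma_ne_top_of_mem hs hsd x
  have hself : rieszEnergy s (sigma d) = rieszPotential s (sigma d) x :=
    mutualEnergy_of_rieszPotential_eq hconst _
  refine le_antisymm (le_iInf fun ν => ?_) ?_
  · have h1 := two_mul_mutualEnergy_le hs (sigma d) (ν : Measure (Sph d))
    rw [mutualEnergy_of_rieszPotential_eq hconst, hself, two_mul] at h1
    exact (ENNReal.add_le_add_iff_left hfin).1 h1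
  · exact (iInf_le _ (⟨sigma d, inferInstance⟩ : ProbabilityMeasure (Sph d))).trans_eq hself

theorem sphereEnergy_ne_top {d : ℕ} {s : ℝ} (hs : 0 < s) (hsd : s < d) : sphereEnergy d s ≠ ∞ := by
  obtain ⟨x⟩ := nonempty_sphere d
  rw [← rieszPotential_sigma_eq_sphereEnergy hs hsd x]
  exact rieszPotential_sigma_ne_top_of_mem hs hsd x

theorem rieszPotential_ne_zero {d : ℕ} {s : ℝ} (hs : 0 < s) {μ : Measure (Sph d)} (hμ : μ ≠ 0)
    (x : Space d) : rieszPotential s μ x ≠ 0 := by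
  have h : ∀ y : Sph d, 0 < edist x (y : Space d) ^ (-s) := fun y => by
    rw [ENNReal.rpow_neg]
    exact ENNReal.inv_pos.2 (ENNReal.rpow_ne_top_of_nonneg hs.le (edist_ne_top _ _))
  rw [rieszPotential, ← pos_iff_ne_zero, lintegral_pos_iff_support (by fun_prop)]
  have : Function.support (fun y : Sph d => edist x (y : Space d) ^ (-s)) = Set.univ :=
    Set.eq_univ_of_forall fun y => (h y).ne'
  rw [this]
  exact pos_iff_ne_zero.2 (Measure.measure_univ_ne_zero.2 hμ)

theorem sphereEnergy_ne_zero {d : ℕ} {s : ℝ} (hs : 0 < s) (hsd : s < d) : sphereEnergy d s ≠ 0 := by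
  obtain ⟨x⟩ := nonempty_sphere d
  rw [← rieszPotential_sigma_eq_sphereEnergy hs hsd x]
  exact rieszPotential_ne_zero hs (IsProbabilityMeasure.ne_zero _) _

/-! ### Extremal measures -/

section Extremal

variable {d : ℕ} {s : ℝ} {Q : Space d → ℝ}

/-- The weighted potential `U_s^μ + Q`, for a nonnegative field `Q`. -/
def weightedPotential (s : ℝ) (Q : Space d → ℝ) (μ : Measure (Sph d)) (x : Sph d) : ℝ≥0∞ :=
  rieszPotential s μ x + ENNReal.ofReal (Q x)

theorem measurable_field (hQ : Continuous fun x : Sph d => Q x) :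
    Measurable fun x : Sph d => ENNReal.ofReal (Q x) :=
  hQ.measurable.ennreal_ofReal

theorem lintegral_field_ne_top (hQ : Continuous fun x : Sph d => Q x) (μ : Measure (Sph d))
    [IsFiniteMeasure μ] : ∫⁻ x : Sph d, ENNReal.ofReal (Q x) ∂μ ≠ ∞ := by
  have : Integrable (fun x : Sph d => Q x) μ := hQ.integrable_of_hasCompactSupport
    (HasCompactSupport.of_compactSpace _)
  exact this.lintegral_lt_top.ne

theorem weightedEnergy_eq (hQ : Continuous fun x : Sph d => Q x) (hQ0 : ∀ x : Sph d, 0 ≤ Q x)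
    (μ : Measure (Sph d)) [IsFiniteMeasure μ] :
    weightedEnergy s Q μ =
      ((rieszEnergy s μ + 2 * ∫⁻ x : Sph d, ENNReal.ofReal (Q x) ∂μ : ℝ≥0∞) : EReal) := by
  have hi : Integrable (fun x : Sph d => Q x) μ := hQ.integrable_of_hasCompactSupport
    (HasCompactSupport.of_compactSpace _)
  have h0 : 0 ≤ ∫ x : Sph d, Q x ∂μ := integral_nonneg hQ0
  have h2 : 2 * ENNReal.ofReal (∫ x : Sph d, Q x ∂μ) =
      ENNReal.ofReal (2 * ∫ x : Sph d, Q x ∂μ) := by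
    rw [ENNReal.ofReal_mul zero_le_two, ENNReal.ofReal_ofNat]
  rw [weightedEnergy, EReal.coe_ennreal_add]
  congr 1
  rw [← ofReal_integral_eq_lintegral_ofReal hi (Filter.Eventually.of_forall hQ0),
    h2, EReal.coe_ennreal_ofReal, max_eq_left (by positivity)]

theorem isExtremal_iff (hQ : Continuous fun x : Sph d => Q x) (hQ0 : ∀ x : Sph d, 0 ≤ Q x)
    (μ : ProbabilityMeasure (Sph d)) :
    IsExtremal s Q μ ↔ ∀ ν : ProbabilityMeasure (Sph d),
      rieszEnergy s (μ : Measure (Sph d)) + 2 * ∫⁻ x : Sph d, ENNReal.ofReal (Q x) ∂μ ≤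
      rieszEnergy s (ν : Measure (Sph d)) + 2 * ∫⁻ x : Sph d, ENNReal.ofReal (Q x) ∂ν := by
  simp only [← EReal.coe_ennreal_le_coe_ennreal_iff, ← weightedEnergy_eq hQ hQ0]
  constructor
  · intro h ν
    rw [h]
    exact iInf_le _ ν
  · intro h
    exact le_antisymm (le_iInf h) (iInf_le _ μ)

theorem lintegral_weightedPotential (hQ : Continuous fun x : Sph d => Q x)
    (μ ν : Measure (Sph d)) :
    ∫⁻ x, weightedPotential s Q μ x ∂ν =
      mutualEnergy s μ ν + ∫⁻ x : Sph d, ENNReal.ofReal (Q x) ∂ν :=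
  lintegral_add_right _ (measurable_field hQ)

/-- A probability measure with constant weighted potential is extremal. -/
theorem isExtremal_of_weightedPotential_eq (hs : 0 < s) (hQ : Continuous fun x : Sph d => Q x)
    (hQ0 : ∀ x : Sph d, 0 ≤ Q x) {μ : ProbabilityMeasure (Sph d)} {G : ℝ≥0∞} (hG : G ≠ ∞)
    (h : ∀ x : Sph d, weightedPotential s Q (μ : Measure (Sph d)) x = G) : IsExtremal s Q μ := by
  refine (isExtremal_iff hQ hQ0 μ).2 fun ν => ?_
  have hμ := lintegral_weightedPotential (s := s) hQ (μ : Measure (Sph d)) μ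
  have hν := lintegral_weightedPotential (s := s) hQ (μ : Measure (Sph d)) ν
  simp only [h, lintegral_const, measure_univ, mul_one] at hμ hν
  have hpsd := two_mul_mutualEnergy_le hs (μ : Measure (Sph d)) ν
  rw [mutualEnergy_self] at hμ
  set a := ∫⁻ x : Sph d, ENNReal.ofReal (Q x) ∂(μ : Measure (Sph d))
  set b := ∫⁻ x : Sph d, ENNReal.ofReal (Q x) ∂(ν : Measure (Sph d))
  have hA : rieszEnergy s (μ : Measure (Sph d)) ≠ ∞ :=
    ne_top_of_le_ne_top hG (hμ ▸ le_self_add)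
  refine (ENNReal.add_le_add_iff_left hA).1 ?_
  calc rieszEnergy s (μ : Measure (Sph d)) + (rieszEnergy s (μ : Measure (Sph d)) + 2 * a)
      = 2 * G := by rw [hμ]; ring
    _ = 2 * mutualEnergy s (μ : Measure (Sph d)) ν + 2 * b := by rw [hν]; ring
    _ ≤ _ := by rw [← add_assoc]; gcongr

theorem rieszPotential_add (μ ν : Measure (Sph d)) (x : Space d) :
    rieszPotential s (μ + ν) x = rieszPotential s μ x + rieszPotential s ν x :=
  lintegral_add_measure _ _ _

theorem rieszPotential_smul (c : ℝ≥0∞) (μ : Measure (Sph d)) (x : Space d) :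
    rieszPotential s (c • μ) x = c * rieszPotential s μ x :=
  lintegral_smul_measure _ _

theorem lowerSemicontinuous_rieszPotential (s : ℝ) (μ : Measure (Sph d)) :
    LowerSemicontinuous fun x : Sph d => rieszPotential s μ x := by
  intro x c hc
  refine Filter.eventually_lt_of_lt_liminf (lt_of_lt_of_le hc ?_)
  refine le_trans (le_of_eq ?_) (lintegral_liminf_le (fun x => by fun_prop))
  refine lintegral_congr fun y => ?_
  refine (Filter.Tendsto.liminf_eq ?_).symm
  exact Continuous.tendsto (ENNReal.continuous_rpow_const.comp (by fun_prop)) x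

/-- First-order condition: an extremal measure minimizes the integral of its own weighted
potential. -/
theorem lintegral_weightedPotential_le_of_isExtremal (hs : 0 < s)
    (hQ : Continuous fun x : Sph d => Q x) (hQ0 : ∀ x : Sph d, 0 ≤ Q x)
    {μ : ProbabilityMeasure (Sph d)} (h : IsExtremal s Q μ)
    (hμ : rieszEnergy s (μ : Measure (Sph d)) ≠ ∞) (ν : Measure (Sph d)) [IsProbabilityMeasure ν]
    (hν : rieszEnergy s ν ≠ ∞) :
    ∫⁻ x, weightedPotential s Q μ x ∂(μ : Measure (Sph d)) ≤
      ∫⁻ x, weightedPotential s Q μ x ∂ν := by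
  rw [isExtremal_iff hQ hQ0] at h
  rw [lintegral_weightedPotential hQ, lintegral_weightedPotential hQ, mutualEnergy_self]
  have hM : mutualEnergy s (μ : Measure (Sph d)) ν ≠ ∞ := by
    have := ne_top_of_le_ne_top (ENNReal.add_ne_top.2 ⟨hμ, hν⟩)
      (two_mul_mutualEnergy_le hs (μ : Measure (Sph d)) ν)
    exact fun h => this (by simp [h])
  have ha := lintegral_field_ne_top hQ (μ : Measure (Sph d))
  have hb := lintegral_field_ne_top hQ ν
  have key : ∀ t : NNReal, 0 < t → t ≤ 1 →
      rieszEnergy s (μ : Measure (Sph d)) + 2 * ∫⁻ x : Sph d, ENNReal.ofReal (Q x) ∂μ ≤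
      (((1 - t : NNReal) : ℝ≥0∞) ^ 2 * rieszEnergy s (μ : Measure (Sph d)) +
        2 * ((1 - t : NNReal) : ℝ≥0∞) * t * mutualEnergy s (μ : Measure (Sph d)) ν +
        (t : ℝ≥0∞) ^ 2 * rieszEnergy s ν) +
      2 * (((1 - t : NNReal) : ℝ≥0∞) * ∫⁻ x : Sph d, ENNReal.ofReal (Q x) ∂μ +
        t * ∫⁻ x : Sph d, ENNReal.ofReal (Q x) ∂ν) := by
    intro t _ ht1
    set r : NNReal := 1 - t with hr
    have hrt : (r : ℝ≥0∞) + t = 1 := by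
      rw [← ENNReal.coe_add, hr, tsub_add_cancel_of_le ht1, ENNReal.coe_one]
    have hp : IsProbabilityMeasure ((r : ℝ≥0∞) • (μ : Measure (Sph d)) + (t : ℝ≥0∞) • ν) :=
      ⟨by simp [hrt]⟩
    refine (h ⟨_, hp⟩).trans_eq ?_
    simp only [ProbabilityMeasure.coe_mk]
    congr 1
    · have hcomm := mutualEnergy_comm s (μ : Measure (Sph d)) ν
      have m1 := measurable_rieszPotential s (μ : Measure (Sph d))
      have m2 := measurable_rieszPotential s ν
      simp only [rieszEnergy, rieszPotential_add, rieszPotential_smul, lintegral_add_measure,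
        lintegral_smul_measure, smul_eq_mul]
      rw [lintegral_add_left (by fun_prop), lintegral_add_left (by fun_prop),
        lintegral_const_mul _ m1, lintegral_const_mul _ m2, lintegral_const_mul _ m1,
        lintegral_const_mul _ m2]
      change (r : ℝ≥0∞) * (r * mutualEnergy s (μ : Measure (Sph d)) μ +
        t * mutualEnergy s ν (μ : Measure (Sph d))) +
        t * (r * mutualEnergy s (μ : Measure (Sph d)) ν + t * mutualEnergy s ν ν) = _
      rw [← hcomm, mutualEnergy, mutualEnergy, mutualEnergy]
      ring
    · rw [lintegral_add_measure, lintegral_smul_measure, lintegral_smul_measure, smul_eq_mul,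
        smul_eq_mul]
  generalize rieszEnergy s (μ : Measure (Sph d)) = A at *
  generalize rieszEnergy s ν = C at *
  generalize mutualEnergy s (μ : Measure (Sph d)) ν = M at *
  generalize ∫⁻ x : Sph d, ENNReal.ofReal (Q x) ∂(μ : Measure (Sph d)) = a at *
  generalize ∫⁻ x : Sph d, ENNReal.ofReal (Q x) ∂ν = b at *
  lift A to NNReal using hμ
  lift C to NNReal using hν
  lift M to NNReal using hM
  lift a to NNReal using ha
  lift b to NNReal using hb
  norm_cast at key ⊢
  have key' : ∀ t : ℝ, 0 < t → t ≤ 1 →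
      (A : ℝ) + 2 * a ≤ ((1 - t) ^ 2 * A + 2 * (1 - t) * t * M + t ^ 2 * C) +
        2 * ((1 - t) * a + t * b) := by
    intro t ht ht1
    lift t to NNReal using ht.le
    have := key t (by exact_mod_cast ht) (by exact_mod_cast ht1)
    rw [← NNReal.coe_le_coe] at this
    push_cast [NNReal.coe_sub (show t ≤ 1 by exact_mod_cast ht1)] at this
    exact this
  rw [← NNReal.coe_le_coe]
  push_cast
  by_contra hlt
  push Not at hlt
  -- The quadratic in `t` has negative slope `-2δ` at `0`.
  set δ : ℝ := A + a - (M + b) with hδ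
  have hδ0 : 0 < δ := by linarith
  have hD : 0 < |(A : ℝ) - 2 * M + C| + δ := by positivity
  have ht0 : 0 < δ / (|(A : ℝ) - 2 * M + C| + δ) := by positivity
  have ht1 : δ / (|(A : ℝ) - 2 * M + C| + δ) ≤ 1 := by
    rw [div_le_one hD]
    linarith [abs_nonneg ((A : ℝ) - 2 * M + C)]
  have h1 := key' _ ht0 ht1
  set t := δ / (|(A : ℝ) - 2 * M + C| + δ) with ht
  have h2 : t * (|(A : ℝ) - 2 * M + C| + δ) = δ := div_mul_cancel₀ _ hD.ne'
  have h3 : 0 ≤ t * (-2 * δ + t * ((A : ℝ) - 2 * M + C)) := by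
    rw [hδ]; linarith
  have h4 : 0 ≤ -2 * δ + t * ((A : ℝ) - 2 * M + C) := nonneg_of_mul_nonneg_right h3 ht0
  have h5 : t * ((A : ℝ) - 2 * M + C) ≤ t * |(A : ℝ) - 2 * M + C| :=
    mul_le_mul_of_nonneg_left (le_abs_self _) ht0.le
  nlinarith

/-- The weighted potential of an extremal measure of full support is constant almost everywhere
with respect to the sphere measure. -/
theorem ae_weightedPotential_eq_of_isExtremal (hs : 0 < s) (hsd : s < d)
    (hQ : Continuous fun x : Sph d => Q x) (hQ0 : ∀ x : Sph d, 0 ≤ Q x)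
    {μ : ProbabilityMeasure (Sph d)} (h : IsExtremal s Q μ)
    (hsupp : (μ : Measure (Sph d)).support = Set.univ) :
    ∃ B : ℝ≥0∞, B ≠ ∞ ∧ ∀ᵐ x ∂sigma d, weightedPotential s Q μ x = B := by
  have hσ : rieszEnergy s (sigma d) ≠ ∞ := by
    have := mutualEnergy_of_rieszPotential_eq (rieszPotential_sigma_eq_sphereEnergy hs hsd)
      (sigma d)
    rw [← mutualEnergy_self, this]
    exact sphereEnergy_ne_top hs hsd
  have hμ : rieszEnergy s (μ : Measure (Sph d)) ≠ ∞ := by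
    have := (isExtremal_iff hQ hQ0 μ).1 h ⟨sigma d, inferInstance⟩
    refine ne_top_of_le_ne_top ?_ (le_self_add.trans this)
    exact ENNReal.add_ne_top.2 ⟨hσ, ENNReal.mul_ne_top (by simp)
      (lintegral_field_ne_top hQ (sigma d))⟩
  have hfirst : ∀ (ν : Measure (Sph d)) [IsProbabilityMeasure ν], rieszEnergy s ν ≠ ∞ →
      ∫⁻ x, weightedPotential s Q μ x ∂(μ : Measure (Sph d)) ≤
        ∫⁻ x, weightedPotential s Q μ x ∂ν := fun ν _ =>
    lintegral_weightedPotential_le_of_isExtremal hs hQ hQ0 h hμ ν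
  set V : Sph d → ℝ≥0∞ := weightedPotential s Q μ with hV
  have hVm : Measurable V := (measurable_rieszPotential s _).add (measurable_field hQ)
  have hVlsc : LowerSemicontinuous V := (lowerSemicontinuous_rieszPotential s _).add
    (ENNReal.continuous_ofReal.comp hQ).lowerSemicontinuous
  set B := ∫⁻ x, V x ∂(μ : Measure (Sph d)) with hB
  have hB1 : B ≠ ∞ := by
    rw [hB, hV, lintegral_weightedPotential hQ]
    exact ENNReal.add_ne_top.2 ⟨hμ, lintegral_field_ne_top hQ _⟩
  have hset : ∀ E : Set (Sph d), B * (μ : Measure (Sph d)) E ≤ ∫⁻ x in E, V x ∂μ := by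
    intro E
    set m := (μ : Measure (Sph d)) E with hm
    rcases eq_or_ne m 0 with h0 | h0
    · simp [h0]
    have hm1 : m ≠ ∞ := measure_ne_top _ _
    have hp : IsProbabilityMeasure (m⁻¹ • (μ : Measure (Sph d)).restrict E) :=
      ⟨by simp [← hm, ENNReal.inv_mul_cancel h0 hm1]⟩
    have hfin : rieszEnergy s (m⁻¹ • (μ : Measure (Sph d)).restrict E) ≠ ∞ := by
      have hle : rieszEnergy s (m⁻¹ • (μ : Measure (Sph d)).restrict E) ≤
          m⁻¹ * (m⁻¹ * rieszEnergy s (μ : Measure (Sph d))) := by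
        simp only [rieszEnergy, rieszPotential_smul, lintegral_smul_measure, smul_eq_mul]
        gcongr
        rw [← lintegral_const_mul _ (measurable_rieszPotential s _)]
        refine lintegral_mono' Measure.restrict_le_self fun x => ?_
        dsimp only
        gcongr
        exact lintegral_mono' Measure.restrict_le_self le_rfl
      exact ne_top_of_le_ne_top (ENNReal.mul_ne_top (ENNReal.inv_ne_top.2 h0)
        (ENNReal.mul_ne_top (ENNReal.inv_ne_top.2 h0) hμ)) hle
    have h1 := hfirst _ hfin
    rw [lintegral_smul_measure, smul_eq_mul] at h1
    calc B * m ≤ (m⁻¹ * ∫⁻ x in E, V x ∂μ) * m := by gcongr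
      _ = _ := by rw [mul_comm, ← mul_assoc, ENNReal.mul_inv_cancel h0 hm1, one_mul]
  have hle : ∀ x, V x ≤ B := by
    by_contra hcon
    push Not at hcon
    obtain ⟨x₀, hx₀⟩ := hcon
    set E : Set (Sph d) := {x | B < V x} with hE
    have hEm : MeasurableSet E := measurableSet_lt measurable_const hVm
    have hE0 : (μ : Measure (Sph d)) E ≠ 0 := by
      have hx : x₀ ∈ (μ : Measure (Sph d)).support := by rw [hsupp]; trivial
      exact ((Measure.mem_support_iff_forall x₀).1 hx E (hVlsc x₀ B hx₀)).ne'
    have h1 : B * (μ : Measure (Sph d)) E < ∫⁻ x in E, V x ∂μ := by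
      rw [← setLIntegral_const]
      refine setLIntegral_strict_mono hEm hE0 hVm ?_ (Filter.Eventually.of_forall fun x hx => hx)
      rw [setLIntegral_const]
      exact ENNReal.mul_ne_top hB1 (measure_ne_top _ _)
    have h2 := hset Eᶜ
    have h3 : B < B := by
      calc B = B * (μ : Measure (Sph d)) E + B * (μ : Measure (Sph d)) Eᶜ := by
            rw [← mul_add, measure_add_measure_compl hEm, measure_univ, mul_one]
        _ < (∫⁻ x in E, V x ∂μ) + ∫⁻ x in Eᶜ, V x ∂μ :=
            ENNReal.add_lt_add_of_lt_of_le (ENNReal.mul_ne_top hB1 (measure_ne_top _ _)) h1 h2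
        _ = B := lintegral_add_compl _ hEm
    exact h3.false
  refine ⟨B, hB1, ?_⟩
  have h1 := hfirst (sigma d) hσ
  have h2 : ∫⁻ x, V x ∂sigma d = ∫⁻ _, B ∂sigma d :=
    le_antisymm (lintegral_mono hle) (by simpa using h1)
  exact ae_eq_of_ae_le_of_lintegral_le (Filter.Eventually.of_forall hle)
    (by rw [h2]; simpa using hB1) measurable_const.aemeasurable h2.ge

end Extremal

/-! ### A generalized Stieltjes transform -/

section Stieltjes

variable {X : Type*} [MeasurableSpace X] {ν ν₁ ν₂ : Measure X} {t : X → ℝ}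

/-- The generalized Stieltjes transform `A ↦ ∫ (A - t)^{-p} dν`. -/
def stieltjes (ν : Measure X) (t : X → ℝ) (p A : ℝ) : ℝ := ∫ x, (A - t x) ^ (-p) ∂ν

theorem integrable_sub_rpow [IsFiniteMeasure ν] (ht : Measurable t) (ht1 : ∀ x, t x ≤ 1) {p A : ℝ}
    (hp : 0 ≤ p) (hA : 1 < A) : Integrable (fun x => (A - t x) ^ (-p)) ν := by
  refine Integrable.of_bound (C := (A - 1) ^ (-p))
    (Measurable.aestronglyMeasurable (by fun_prop))
    (Filter.Eventually.of_forall fun x => ?_)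
  have h1 : A - 1 ≤ A - t x := by linarith [ht1 x]
  rw [Real.norm_of_nonneg (Real.rpow_nonneg (by linarith) _)]
  exact Real.rpow_le_rpow_of_nonpos (by linarith) h1 (by linarith)

theorem hasDerivAt_stieltjes [IsFiniteMeasure ν] (ht : Measurable t) (ht1 : ∀ x, t x ≤ 1) {p A : ℝ}
    (hp : 0 ≤ p) (hA : 1 < A) :
    HasDerivAt (stieltjes ν t p) (-p * stieltjes ν t (p + 1) A) A := by
  have hB : 1 < (1 + A) / 2 := by linarith
  have hs : Set.Ioi ((1 + A) / 2) ∈ nhds A := Ioi_mem_nhds (by linarith)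
  have h := (hasDerivAt_integral_of_dominated_loc_of_deriv_le (μ := ν)
    (F := fun A x => (A - t x) ^ (-p)) (F' := fun A x => -p * (A - t x) ^ (-(p + 1)))
    (bound := fun _ => p * ((1 + A) / 2 - 1) ^ (-(p + 1))) hs
    (Filter.Eventually.of_forall fun B => Measurable.aestronglyMeasurable (by fun_prop))
    (integrable_sub_rpow ht ht1 hp hA) (Measurable.aestronglyMeasurable (by fun_prop))
    (Filter.Eventually.of_forall fun x B hB' => ?_) (integrable_const _)
    (Filter.Eventually.of_forall fun x B hB' => ?_)).2
  · rw [integral_const_mul] at h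
    exact h
  · have hB' : (1 + A) / 2 < B := hB'
    have h1 : (1 + A) / 2 - 1 ≤ B - t x := by linarith [ht1 x]
    rw [norm_mul, Real.norm_of_nonneg (Real.rpow_nonneg (by linarith) _), norm_neg,
      Real.norm_of_nonneg hp]
    exact mul_le_mul_of_nonneg_left
      (Real.rpow_le_rpow_of_nonpos (by linarith) h1 (by linarith)) hp
  · have hB' : (1 + A) / 2 < B := hB'
    have h1 : B - t x ≠ 0 := by linarith [ht1 x]
    have := ((hasDerivAt_id B).sub_const (t x)).rpow_const (p := -p) (Or.inl h1)
    convert! this using 1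
    simp only [id]
    rw [neg_add, ← sub_eq_add_neg]
    ring

/-- Equality of the transforms of one positive order propagates, by differentiation, to all higher
orders. -/
theorem stieltjes_add_natCast_eq [IsFiniteMeasure ν₁] [IsFiniteMeasure ν₂] (ht : Measurable t)
    (ht1 : ∀ x, t x ≤ 1) {p : ℝ} (hp : 0 < p)
    (h : ∀ A, 1 < A → stieltjes ν₁ t p A = stieltjes ν₂ t p A) (k : ℕ) {A : ℝ} (hA : 1 < A) :
    stieltjes ν₁ t (p + k) A = stieltjes ν₂ t (p + k) A := by
  induction k generalizing A with
  | zero => simpa using h A hA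
  | succ k ih =>
    have hpk : 0 < p + k := by positivity
    have h1 := hasDerivAt_stieltjes (ν := ν₁) ht ht1 hpk.le hA
    have h2 := hasDerivAt_stieltjes (ν := ν₂) ht ht1 hpk.le hA
    have heq : stieltjes ν₁ t (p + k) =ᶠ[nhds A] stieltjes ν₂ t (p + k) := by
      filter_upwards [Ioi_mem_nhds hA] with B hB using ih hB
    have h3 := (h1.congr_of_eventuallyEq heq.symm).unique h2
    have h4 := mul_left_cancel₀ (neg_ne_zero.2 hpk.ne') h3
    push_cast
    rw [← add_assoc]
    exact h4

/-- The transform of one positive order determines the distribution of `t`. -/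
theorem integral_comp_eq_of_stieltjes_eq [IsFiniteMeasure ν₁] [IsFiniteMeasure ν₂]
    (ht : Measurable t) (ht1 : ∀ x, t x ≤ 1) (ht2 : ∀ x, -1 ≤ t x) {p : ℝ} (hp : 0 < p)
    (h : ∀ A, 1 < A → stieltjes ν₁ t p A = stieltjes ν₂ t p A) {f : ℝ → ℝ} (hf : Continuous f) :
    ∫ x, f (t x) ∂ν₁ = ∫ x, f (t x) ∂ν₂ := by
  have hw : ∀ x, (2 - t x)⁻¹ ∈ Set.Icc (1 / 3 : ℝ) 1 := fun x => by
    have h1 : 1 ≤ 2 - t x := by linarith [ht1 x]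
    have h3 : 2 - t x ≤ 3 := by linarith [ht2 x]
    refine ⟨?_, inv_le_one_of_one_le₀ h1⟩
    rw [one_div]
    exact inv_anti₀ (by linarith) h3
  -- The powers of `w = (2 - t)⁻¹` integrate equally against `(2 - t)^{-p} dνᵢ`.
  have hpoly : ∀ P : Polynomial ℝ,
      ∫ x, P.eval ((2 - t x)⁻¹) * (2 - t x) ^ (-p) ∂ν₁ =
        ∫ x, P.eval ((2 - t x)⁻¹) * (2 - t x) ^ (-p) ∂ν₂ := by
    have hpow : ∀ (k : ℕ) (x : X), ((2 - t x)⁻¹) ^ k * (2 - t x) ^ (-p) =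
        (2 - t x) ^ (-(p + k)) := fun k x => by
      have : 0 < 2 - t x := by linarith [ht1 x]
      rw [neg_add, Real.rpow_add this, Real.rpow_neg this.le (k : ℝ), Real.rpow_natCast, inv_pow,
        mul_comm]
    intro P
    have hexp : ∀ x, P.eval ((2 - t x)⁻¹) * (2 - t x) ^ (-p) =
        ∑ k ∈ Finset.range (P.natDegree + 1), P.coeff k * (2 - t x) ^ (-(p + k)) := fun x => by
      rw [Polynomial.eval_eq_sum_range, Finset.sum_mul]
      refine Finset.sum_congr rfl fun k _ => ?_
      rw [mul_assoc, hpow]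
    simp only [hexp]
    rw [integral_finsetSum _ fun k _ => (integrable_sub_rpow ht ht1 (by positivity)
      one_lt_two).const_mul _, integral_finsetSum _ fun k _ => (integrable_sub_rpow ht ht1
        (by positivity) one_lt_two).const_mul _]
    refine Finset.sum_congr rfl fun k _ => ?_
    rw [integral_const_mul, integral_const_mul]
    exact congrArg _ (stieltjes_add_natCast_eq ht ht1 hp h k one_lt_two)
  set g : ℝ → ℝ := fun w => f (2 - w⁻¹) * w ^ (-p) with hg
  have hgc : ContinuousOn g (Set.Icc (1 / 3) 1) := by
    intro w hw
    have : w ≠ 0 := by linarith [hw.1]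
    refine ContinuousAt.continuousWithinAt ?_
    refine (hf.continuousAt.comp (continuousAt_const.sub (continuousAt_inv₀ this))).mul ?_
    exact Real.continuousAt_rpow_const _ _ (Or.inl this)
  have hfg : ∀ x, f (t x) = g ((2 - t x)⁻¹) * (2 - t x) ^ (-p) := fun x => by
    have : 0 < 2 - t x := by linarith [ht1 x]
    simp only [hg]
    rw [inv_inv, sub_sub_cancel, mul_assoc, ← Real.mul_rpow (inv_nonneg.2 this.le) this.le,
      inv_mul_cancel₀ this.ne', Real.one_rpow, mul_one]
  have hfi : ∀ ν : Measure X, IsFiniteMeasure ν → Integrable (fun x => f (t x)) ν := by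
    intro ν _
    obtain ⟨C, hC⟩ := isCompact_Icc.exists_bound_of_continuousOn (s := Set.Icc (-1 : ℝ) 1)
      hf.continuousOn
    exact Integrable.of_bound (hf.measurable.comp ht).aestronglyMeasurable C
      (Filter.Eventually.of_forall fun x => hC _ ⟨ht2 x, ht1 x⟩)
  have hest : ∀ (ν : Measure X) (_ : IsFiniteMeasure ν) (P : Polynomial ℝ) (ε : ℝ),
      (∀ w ∈ Set.Icc (1 / 3 : ℝ) 1, |P.eval w - g w| < ε) →
      |∫ x, P.eval ((2 - t x)⁻¹) * (2 - t x) ^ (-p) ∂ν - ∫ x, f (t x) ∂ν| ≤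
        ε * stieltjes ν t p 2 := by
    intro ν _ P ε hP
    have hPi : Integrable (fun x => P.eval ((2 - t x)⁻¹) * (2 - t x) ^ (-p)) ν := by
      obtain ⟨C, hC⟩ := isCompact_Icc.exists_bound_of_continuousOn (s := Set.Icc (1 / 3 : ℝ) 1)
        P.continuous.continuousOn
      exact (integrable_sub_rpow ht ht1 hp.le one_lt_two).bdd_mul
        (P.continuous.measurable.comp (by fun_prop)).aestronglyMeasurable
        (Filter.Eventually.of_forall fun x => hC _ (hw x))
    rw [← integral_sub hPi (hfi ν inferInstance), stieltjes, ← integral_const_mul,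
      ← Real.norm_eq_abs]
    refine norm_integral_le_of_norm_le ((integrable_sub_rpow ht ht1 hp.le one_lt_two).const_mul _)
      (Filter.Eventually.of_forall fun x => ?_)
    have h0 : 0 ≤ (2 - t x) ^ (-p) := Real.rpow_nonneg (by linarith [ht1 x]) _
    rw [hfg, ← sub_mul, norm_mul, Real.norm_of_nonneg h0, Real.norm_eq_abs]
    exact mul_le_mul_of_nonneg_right (hP _ (hw x)).le h0
  have hH0 : ∀ ν : Measure X, 0 ≤ stieltjes ν t p 2 := fun ν =>
    integral_nonneg fun x => Real.rpow_nonneg (by linarith [ht1 x]) _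
  refine eq_of_abs_sub_le_all fun ε hε => ?_
  set D := stieltjes ν₁ t p 2 + stieltjes ν₂ t p 2 + 1 with hD
  have hDpos : 0 < D := by linarith [hH0 ν₁, hH0 ν₂]
  obtain ⟨P, hP⟩ := exists_polynomial_near_of_continuousOn _ _ g hgc (ε / D) (by positivity)
  have e1 := hest ν₁ inferInstance P _ hP
  have e2 := hest ν₂ inferInstance P _ hP
  rw [hpoly P] at e1
  have e3 : ε / D * D = ε := div_mul_cancel₀ _ hDpos.ne'
  rw [abs_le] at e1 e2 ⊢
  have : ε / D * (stieltjes ν₁ t p 2 + stieltjes ν₂ t p 2) ≤ ε := by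
    refine le_trans (mul_le_mul_of_nonneg_left ?_ (by positivity)) e3.le
    linarith
  constructor <;> linarith

end Stieltjes

/-! ### Measures are determined by their potentials -/

section Determination

variable {d : ℕ} {s : ℝ} {ν₁ ν₂ : Measure (Sph d)}

theorem lintegral_norm_sub_rpow_mul_sphereEnergy (hs : 0 < s) (hsd : s < d) {a : Space d}
    (ha : 1 < ‖a‖) (ν : Measure (Sph d)) [IsFiniteMeasure ν] :
    (∫⁻ x : Sph d, ENNReal.ofReal (‖(x : Space d) - a‖ ^ (-s)) ∂ν) * sphereEnergy d s =
      ∫⁻ y : Sph d, rieszPotential s ν y * ENNReal.ofReal (kelvinDensity d s a y) ∂sigma d := by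
  have hκ : Measurable fun y : Sph d => ENNReal.ofReal (kelvinDensity d s a y) := by
    unfold kelvinDensity; fun_prop
  have h1 : ∀ x : Sph d, ENNReal.ofReal (‖(x : Space d) - a‖ ^ (-s)) * sphereEnergy d s =
      ∫⁻ y : Sph d, edist (x : Space d) (y : Space d) ^ (-s) *
        ENNReal.ofReal (kelvinDensity d s a y) ∂sigma d := fun x => by
    rw [lintegral_edist_mul_kelvinDensity s ha (by simp),
      rieszPotential_sigma_eq_sphereEnergy hs hsd]
  rw [← lintegral_mul_const _ (by fun_prop), lintegral_congr h1, lintegral_lintegral_swap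
    (by unfold kelvinDensity; fun_prop)]
  refine lintegral_congr fun y => ?_
  rw [lintegral_mul_const _ (by fun_prop), rieszPotential]
  simp only [edist_comm]

theorem norm_sub_smul_sq {R : ℝ} {x u : Space d} (hx : ‖x‖ = 1) (hu : ‖u‖ = 1) :
    ‖x - R • u‖ ^ 2 = R ^ 2 + 1 - 2 * R * ⟪x, u⟫ := by
  rw [@norm_sub_sq_real, norm_smul, hx, hu, inner_smul_right, mul_one, Real.norm_eq_abs, sq_abs]
  ring

/-- The kernel of a unit charge at `R u` in terms of the height `⟪x, u⟫` and of the Joukowski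
parameter `A = (R + R⁻¹) / 2`. -/
theorem norm_sub_smul_rpow {R A p : ℝ} (hR : 0 < R) (hRA : 2 * R * A = R ^ 2 + 1) (hA : 1 < A)
    {x u : Space d} (hx : ‖x‖ = 1) (hu : ‖u‖ = 1) :
    ‖x - R • u‖ ^ (-p) = (2 * R) ^ (-(p / 2)) * (A - ⟪x, u⟫) ^ (-(p / 2)) := by
  have h1 : ⟪x, u⟫ ≤ 1 := by
    have := real_inner_le_norm x u
    rwa [hx, hu, one_mul] at this
  rw [← Real.mul_rpow (by positivity) (by linarith), mul_sub, hRA, ← norm_sub_smul_sq hx hu,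
    ← Real.rpow_natCast, ← Real.rpow_mul (norm_nonneg _)]
  congr 1
  push_cast
  ring

/-- A finite measure on the sphere is determined by its potential almost everywhere with respect to
the sphere measure. -/
theorem measure_eq_of_rieszPotential_ae_eq (hs : 0 < s) (hsd : s < d)
    [IsFiniteMeasure ν₁] [IsFiniteMeasure ν₂]
    (h : ∀ᵐ x : Sph d ∂sigma d, rieszPotential s ν₁ x = rieszPotential s ν₂ x) : ν₁ = ν₂ := by
  have hext : ∀ a : Space d, 1 < ‖a‖ →
      ∫⁻ x : Sph d, ENNReal.ofReal (‖(x : Space d) - a‖ ^ (-s)) ∂ν₁ =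
        ∫⁻ x : Sph d, ENNReal.ofReal (‖(x : Space d) - a‖ ^ (-s)) ∂ν₂ := fun a ha => by
    refine (ENNReal.mul_left_inj (sphereEnergy_ne_zero hs hsd) (sphereEnergy_ne_top hs hsd)).1 ?_
    rw [lintegral_norm_sub_rpow_mul_sphereEnergy hs hsd ha,
      lintegral_norm_sub_rpow_mul_sphereEnergy hs hsd ha]
    refine lintegral_congr_ae ?_
    filter_upwards [h] with y hy
    rw [hy]
  have hcont : ∀ (u : Space d), ‖u‖ = 1 → ∀ f : ℝ → ℝ, Continuous f →
      ∫ x : Sph d, f ⟪(x : Space d), u⟫ ∂ν₁ = ∫ x : Sph d, f ⟪(x : Space d), u⟫ ∂ν₂ := by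
    intro u hu f hf
    have hb : ∀ x : Sph d, |⟪(x : Space d), u⟫| ≤ 1 := fun x => by
      have := abs_real_inner_le_norm (x : Space d) u
      rwa [hu, mul_one, show ‖(x : Space d)‖ = 1 by simp] at this
    refine integral_comp_eq_of_stieltjes_eq (t := fun x : Sph d => ⟪(x : Space d), u⟫)
      (by fun_prop) (fun x => (abs_le.1 (hb x)).2) (fun x => (abs_le.1 (hb x)).1)
      (half_pos hs) (fun A hA => ?_) hf
    set R := A + Real.sqrt (A ^ 2 - 1) with hR
    have hsq : Real.sqrt (A ^ 2 - 1) ^ 2 = A ^ 2 - 1 := Real.sq_sqrt (by nlinarith)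
    have hR1 : 1 < R := by linarith [Real.sqrt_nonneg (A ^ 2 - 1)]
    have hRA : 2 * R * A = R ^ 2 + 1 := by rw [hR]; linear_combination (-1 : ℝ) * hsq
    have hR0 : 0 < (2 * R) ^ (-(s / 2)) := by positivity
    have key : ∀ ν : Measure (Sph d), (2 * R) ^ (-(s / 2)) *
        stieltjes ν (fun x : Sph d => ⟪(x : Space d), u⟫) (s / 2) A =
        (∫⁻ x : Sph d, ENNReal.ofReal (‖(x : Space d) - R • u‖ ^ (-s)) ∂ν).toReal := by
      intro ν
      rw [← integral_eq_lintegral_of_nonneg_ae (Filter.Eventually.of_forall fun x =>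
        Real.rpow_nonneg (norm_nonneg _) _) (Measurable.aestronglyMeasurable (by fun_prop)),
        stieltjes, ← integral_const_mul]
      refine integral_congr_ae (Filter.Eventually.of_forall fun x => ?_)
      exact (norm_sub_smul_rpow (by linarith) hRA hA (by simp) hu).symm
    refine mul_left_cancel₀ hR0.ne' ?_
    rw [key, key, hext _ (by rw [norm_smul, hu, mul_one, Real.norm_of_nonneg] <;> linarith)]
  have hemb : MeasurableEmbedding (Subtype.val : Sph d → Space d) :=
    MeasurableEmbedding.subtype_coe Metric.isClosed_sphere.measurableSet
  refine hemb.map_injective (Measure.ext_of_charFun (funext fun ξ => ?_))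
  obtain ⟨u, hu, hξ⟩ : ∃ u : Space d, ‖u‖ = 1 ∧ ξ = ‖ξ‖ • u := by
    rcases eq_or_ne ξ 0 with rfl | hξ
    · exact ⟨EuclideanSpace.single (Fin.last d) 1, by simp, by simp⟩
    · exact ⟨‖ξ‖⁻¹ • ξ, norm_normalize hξ, by
        rw [smul_smul, mul_inv_cancel₀ (norm_ne_zero_iff.2 hξ), one_smul]⟩
  have hchar : ∀ ν : Measure (Sph d), IsFiniteMeasure ν →
      charFun (ν.map Subtype.val) ξ =
        ((∫ x : Sph d, Real.cos (‖ξ‖ * ⟪(x : Space d), u⟫) ∂ν : ℝ) : ℂ) +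
        ((∫ x : Sph d, Real.sin (‖ξ‖ * ⟪(x : Space d), u⟫) ∂ν : ℝ) : ℂ) * Complex.I := by
    intro ν _
    rw [charFun_apply, hemb.integral_map, ← integral_complex_ofReal, ← integral_complex_ofReal,
      ← integral_mul_const, ← integral_add]
    · refine integral_congr_ae (Filter.Eventually.of_forall fun x => ?_)
      dsimp only
      have : ⟪(x : Space d), ξ⟫ = ‖ξ‖ * ⟪(x : Space d), u⟫ := by
        conv_lhs => rw [hξ]
        rw [inner_smul_right]
      rw [this, Complex.exp_mul_I, Complex.ofReal_cos, Complex.ofReal_sin]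
    · refine Integrable.of_bound (C := 1) (by fun_prop) (Filter.Eventually.of_forall fun x => ?_)
      rw [Complex.norm_real]
      exact Real.abs_cos_le_one _
    · refine Integrable.of_bound (C := 1) (by fun_prop) (Filter.Eventually.of_forall fun x => ?_)
      rw [norm_mul, Complex.norm_I, mul_one, Complex.norm_real]
      exact Real.abs_sin_le_one _
  rw [hchar _ inferInstance, hchar _ inferInstance,
    hcont u hu (fun τ => Real.cos (‖ξ‖ * τ)) (by fun_prop),
    hcont u hu (fun τ => Real.sin (‖ξ‖ * τ)) (by fun_prop)]

end Determination

/-! ### Signed measures as differences -/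

section Signed

variable {X : Type*} [MeasurableSpace X] (μ₁ μ₂ : Measure X) [IsFiniteMeasure μ₁]
  [IsFiniteMeasure μ₂]

theorem posPart_add_eq_negPart_add (η : SignedMeasure X)
    (h : η = μ₁.toSignedMeasure - μ₂.toSignedMeasure) :
    η.toJordanDecomposition.posPart + μ₂ = η.toJordanDecomposition.negPart + μ₁ := by
  ext A hA
  have h1 := η.apply_eq_posPart_real_sub_negPart_real hA
  have h2 : η A = μ₁.real A - μ₂.real A := by
    rw [h, sub_apply, Measure.toSignedMeasure_apply_measurable hA,
      Measure.toSignedMeasure_apply_measurable hA]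
  rw [← ENNReal.toReal_eq_toReal_iff' (measure_ne_top _ _) (measure_ne_top _ _)]
  change (η.toJordanDecomposition.posPart + μ₂).real A =
    (η.toJordanDecomposition.negPart + μ₁).real A
  rw [measureReal_add_apply, measureReal_add_apply]
  linarith

theorem posPart_le (η : SignedMeasure X) (h : η = μ₁.toSignedMeasure - μ₂.toSignedMeasure) :
    η.toJordanDecomposition.posPart ≤ μ₁ := by
  obtain ⟨S, hS, h1, h2⟩ := η.toJordanDecomposition.mutuallySingular
  have hadd := posPart_add_eq_negPart_add μ₁ μ₂ η h
  refine Measure.le_intro fun A hA _ => ?_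
  have h3 := congrArg (fun m : Measure X => m (A ∩ Sᶜ)) hadd
  simp only [Measure.add_apply] at h3
  rw [measure_mono_null Set.inter_subset_right h2, zero_add] at h3
  calc η.toJordanDecomposition.posPart A
      ≤ η.toJordanDecomposition.posPart (A ∩ S) + η.toJordanDecomposition.posPart (A ∩ Sᶜ) :=
        measure_le_inter_add_sdiff _ _ _
    _ = η.toJordanDecomposition.posPart (A ∩ Sᶜ) := by
        rw [measure_mono_null Set.inter_subset_right h1, zero_add]
    _ ≤ μ₁ (A ∩ Sᶜ) := h3 ▸ le_self_add
    _ ≤ μ₁ A := measure_mono Set.inter_subset_left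

end Signed

/-! ### The signed equilibrium -/

section Equilibrium

variable {d : ℕ} {s q R : ℝ}

theorem mutualEnergy_sigma (hs : 0 < s) (hsd : s < d) (ν : Measure (Sph d)) [IsFiniteMeasure ν] :
    ∫⁻ x : Sph d, rieszPotential s ν x ∂sigma d = sphereEnergy d s * ν Set.univ := by
  have h := mutualEnergy_comm s ν (sigma d)
  have h2 : mutualEnergy s (sigma d) ν = sphereEnergy d s * ν Set.univ := by
    simp [mutualEnergy, rieszPotential_sigma_eq_sphereEnergy hs hsd]
  rw [← h2, ← h, mutualEnergy]

/-- Two measures of the same mass whose potentials differ by a constant coincide. -/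
theorem measure_eq_of_rieszPotential_add_const (hs : 0 < s) (hsd : s < d) {ν₁ ν₂ : Measure (Sph d)}
    [IsFiniteMeasure ν₁] [IsFiniteMeasure ν₂] (hmass : ν₁ Set.univ = ν₂ Set.univ) {c₁ c₂ : ℝ≥0∞}
    (hc₁ : c₁ ≠ ∞)
    (h : ∀ᵐ x : Sph d ∂sigma d, rieszPotential s ν₁ x + c₁ = rieszPotential s ν₂ x + c₂) :
    ν₁ = ν₂ := by
  have h1 := lintegral_congr_ae h
  rw [lintegral_add_right _ measurable_const, lintegral_add_right _ measurable_const,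
    mutualEnergy_sigma hs hsd, mutualEnergy_sigma hs hsd, hmass] at h1
  have hfin : sphereEnergy d s * ν₂ Set.univ ≠ ∞ :=
    ENNReal.mul_ne_top (sphereEnergy_ne_top hs hsd) (measure_ne_top _ _)
  have hc : c₁ = c₂ := by simpa using (ENNReal.add_right_inj hfin).1 h1
  refine measure_eq_of_rieszPotential_ae_eq hs hsd ?_
  filter_upwards [h] with x hx
  rw [← hc] at hx
  exact (ENNReal.add_left_inj hc₁).1 hx

/-- The north pole of the sphere. -/
def northPole (d : ℕ) : Sph d := ⟨EuclideanSpace.single (Fin.last d) 1, by simp⟩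

theorem norm_northPole : ‖(northPole d : Space d)‖ = 1 := by simp [northPole]

theorem source_eq (d : ℕ) (R : ℝ) : source d R = R • (northPole d : Space d) := by
  ext i
  simp [source, northPole]

theorem norm_source (hR : 1 < R) : ‖source d R‖ = R := by
  rw [source_eq, norm_smul, norm_northPole, mul_one, Real.norm_of_nonneg (by linarith)]

theorem one_lt_norm_source (hR : 1 < R) : 1 < ‖source d R‖ := by rwa [norm_source hR]

theorem norm_sub_source_sq (R : ℝ) (y : Sph d) : ‖(y : Space d) - source d R‖ ^ 2 =
    (R - 1) ^ 2 + R * ‖(y : Space d) - northPole d‖ ^ 2 := by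
  have h1 := norm_sub_smul_sq (R := R) (x := (y : Space d)) (by simp) (norm_northPole (d := d))
  have h2 := norm_sub_smul_sq (R := 1) (x := (y : Space d)) (by simp) (norm_northPole (d := d))
  rw [one_smul] at h2
  rw [source_eq, h1, h2]
  ring

theorem sub_one_le_norm_sub_source (hR : 1 < R) (y : Sph d) :
    R - 1 ≤ ‖(y : Space d) - source d R‖ := by
  refine le_of_sq_le_sq ?_ (norm_nonneg _)
  rw [norm_sub_source_sq]
  have : 0 ≤ R * ‖(y : Space d) - northPole d‖ ^ 2 := by positivity
  linarith

theorem norm_northPole_sub_source (hR : 1 < R) : ‖(northPole d : Space d) - source d R‖ = R - 1 := by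
  rw [← Real.sqrt_sq (norm_nonneg _), norm_sub_source_sq]
  simp [Real.sqrt_sq (show 0 ≤ R - 1 by linarith)]

theorem sub_one_lt_norm_sub_source (hR : 1 < R) {y : Sph d} (hy : y ≠ northPole d) :
    R - 1 < ‖(y : Space d) - source d R‖ := by
  refine lt_of_pow_lt_pow_left₀ 2 (norm_nonneg _) ?_
  rw [norm_sub_source_sq]
  have : 0 < ‖(y : Space d) - northPole d‖ :=
    norm_pos_iff.2 (sub_ne_zero.2 fun h => hy (Subtype.ext h))
  have : 0 < R * ‖(y : Space d) - northPole d‖ ^ 2 := by positivity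
  linarith

theorem continuous_norm_sub_source_rpow (hR : 1 < R) (p : ℝ) :
    Continuous fun y : Sph d => ‖(y : Space d) - source d R‖ ^ p := by
  refine Continuous.rpow_const (by fun_prop) fun y => Or.inl ?_
  linarith [sub_one_le_norm_sub_source hR y]

theorem externalField_eq (d : ℕ) (R q s : ℝ) (x : Space d) :
    externalField d R q s x = q * ‖x - source d R‖ ^ (-s) := by
  rw [externalField, Real.rpow_neg (norm_nonneg _), div_eq_mul_inv]

theorem continuous_externalField (hR : 1 < R) (q s : ℝ) :
    Continuous fun x : Sph d => externalField d R q s x := by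
  simp only [externalField_eq]
  exact (continuous_norm_sub_source_rpow hR _).const_mul q

theorem externalField_nonneg (hq : 0 < q) (x : Space d) : 0 ≤ externalField d R q s x := by
  unfold externalField
  positivity

theorem rieszPotential_sigma_source (hR : 1 < R) (s : ℝ) : rieszPotential s (sigma d) (source d R) =
    ∫⁻ y : Sph d, ENNReal.ofReal (‖(y : Space d) - source d R‖ ^ (-s)) ∂sigma d := by
  refine lintegral_congr fun y => ?_
  have hne : (y : Space d) ≠ source d R := fun h => by
    have := sub_one_le_norm_sub_source hR y
    rw [h, sub_self, norm_zero] at this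
    linarith
  rw [edist_comm, edist_rpow_eq_ofReal hne]

theorem integrable_norm_sub_source_rpow (hR : 1 < R) (p : ℝ) :
    Integrable (fun y : Sph d => ‖(y : Space d) - source d R‖ ^ p) (sigma d) :=
  (continuous_norm_sub_source_rpow hR p).integrable_of_hasCompactSupport
    (HasCompactSupport.of_compactSpace _)

theorem rieszPotential_sigma_source_ne_top (hR : 1 < R) (s : ℝ) :
    rieszPotential s (sigma d) (source d R) ≠ ∞ := by
  rw [rieszPotential_sigma_source hR]
  exact (integrable_norm_sub_source_rpow hR _).lintegral_lt_top.ne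

theorem sphereEnergy_toReal_pos (hs : 0 < s) (hsd : s < d) : 0 < (sphereEnergy d s).toReal :=
  ENNReal.toReal_pos (sphereEnergy_ne_zero hs hsd) (sphereEnergy_ne_top hs hsd)

/-- The density, relative to the sphere measure, of the measure on the sphere whose potential there
equals the external field. -/
def fieldDensity (d : ℕ) (s q R : ℝ) (y : Space d) : ℝ :=
  q / (sphereEnergy d s).toReal * kelvinDensity d s (source d R) y

/-- The measure on the sphere whose potential there equals the external field. -/
def fieldMeasure (d : ℕ) (s q R : ℝ) : Measure (Sph d) :=
  (sigma d).withDensity fun y => ENNReal.ofReal (fieldDensity d s q R y)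

/-- The total mass of the uniform part of the signed equilibrium. -/
def uniformCharge (d : ℕ) (s q R : ℝ) : ℝ :=
  1 + q / (sphereEnergy d s).toReal * sigmaPotential d s R

theorem continuous_fieldDensity (hR : 1 < R) (s q : ℝ) :
    Continuous fun y : Sph d => fieldDensity d s q R y := by
  unfold fieldDensity kelvinDensity
  exact ((continuous_norm_sub_source_rpow hR _).const_mul _).const_mul _

theorem fieldMeasure_univ (hR : 1 < R) (hs : 0 < s) (hsd : s < d) (hq : 0 < q) :
    fieldMeasure d s q R Set.univ =
      ENNReal.ofReal (q / (sphereEnergy d s).toReal * sigmaPotential d s R) := by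
  have hw := sphereEnergy_toReal_pos hs hsd
  rw [fieldMeasure, withDensity_apply _ MeasurableSet.univ, Measure.restrict_univ]
  simp only [fieldDensity, ENNReal.ofReal_mul (div_pos hq hw).le]
  rw [lintegral_const_mul' _ _ ENNReal.ofReal_ne_top,
    lintegral_kelvinDensity s (one_lt_norm_source hR), sigmaPotential,
    ENNReal.ofReal_toReal (rieszPotential_sigma_source_ne_top hR s)]

theorem isFiniteMeasure_fieldMeasure (hR : 1 < R) (hs : 0 < s) (hsd : s < d) (hq : 0 < q) :
    IsFiniteMeasure (fieldMeasure d s q R) :=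
  ⟨by rw [fieldMeasure_univ hR hs hsd hq]; exact ENNReal.ofReal_lt_top⟩

theorem rieszPotential_fieldMeasure (hR : 1 < R) (hs : 0 < s) (hsd : s < d) (hq : 0 < q)
    (x : Sph d) : rieszPotential s (fieldMeasure d s q R) x =
      ENNReal.ofReal (externalField d R q s x) := by
  have hw := sphereEnergy_toReal_pos hs hsd
  have hm : Measurable fun y : Sph d => ENNReal.ofReal (fieldDensity d s q R y) :=
    (continuous_fieldDensity hR s q).measurable.ennreal_ofReal
  have h1 : ∀ y : Sph d, ENNReal.ofReal (fieldDensity d s q R y) *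
      edist (x : Space d) (y : Space d) ^ (-s) = ENNReal.ofReal (q / (sphereEnergy d s).toReal) *
      (edist (x : Space d) (y : Space d) ^ (-s) *
        ENNReal.ofReal (kelvinDensity d s (source d R) y)) := fun y => by
    rw [fieldDensity, ENNReal.ofReal_mul (div_pos hq hw).le]
    ring
  rw [rieszPotential, fieldMeasure, lintegral_withDensity_eq_lintegral_mul _ hm (by fun_prop)]
  simp only [Pi.mul_apply, h1]
  rw [lintegral_const_mul' _ _ ENNReal.ofReal_ne_top,
    lintegral_edist_mul_kelvinDensity s (one_lt_norm_source hR) (by simp),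
    rieszPotential_sigma_eq_sphereEnergy hs hsd,
    ← ENNReal.ofReal_toReal (sphereEnergy_ne_top hs hsd), ENNReal.toReal_ofReal hw.le,
    ← ENNReal.ofReal_mul (by positivity), ← ENNReal.ofReal_mul (div_pos hq hw).le, externalField_eq]
  congr 1
  field_simp

theorem sigmaPotential_nonneg : 0 ≤ sigmaPotential d s R := ENNReal.toReal_nonneg

theorem uniformCharge_pos (hq : 0 < q) : 0 < uniformCharge d s q R := by
  have := sigmaPotential_nonneg (d := d) (s := s) (R := R)
  unfold uniformCharge
  positivity

theorem rieszPotential_smul_sigma (hs : 0 < s) (hsd : s < d) (c : ℝ≥0∞) (x : Sph d) :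
    rieszPotential s (c • sigma d) x = c * sphereEnergy d s := by
  rw [rieszPotential_smul, rieszPotential_sigma_eq_sphereEnergy hs hsd]

theorem one_add_fieldMeasure_univ (hR : 1 < R) (hs : 0 < s) (hsd : s < d) (hq : 0 < q) :
    1 + fieldMeasure d s q R Set.univ = ENNReal.ofReal (uniformCharge d s q R) := by
  have := sphereEnergy_toReal_pos hs hsd
  have := sigmaPotential_nonneg (d := d) (s := s) (R := R)
  rw [fieldMeasure_univ hR hs hsd hq, uniformCharge, ENNReal.ofReal_add zero_le_one (by positivity),
    ENNReal.ofReal_one]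

/-- A signed equilibrium exists: a uniform charge minus the measure that reproduces the field. -/
theorem isSignedEquilibrium_sub (hR : 1 < R) (hs : 0 < s) (hsd : s < d) (hq : 0 < q)
    [IsFiniteMeasure (fieldMeasure d s q R)]
    [IsFiniteMeasure (ENNReal.ofReal (uniformCharge d s q R) • sigma d)] :
    IsSignedEquilibrium s (externalField d R q s)
      ((ENNReal.ofReal (uniformCharge d s q R) • sigma d).toSignedMeasure -
        (fieldMeasure d s q R).toSignedMeasure) := by
  set μ₁ := ENNReal.ofReal (uniformCharge d s q R) • sigma d with hμ₁
  set μ₂ := fieldMeasure d s q R with hμ₂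
  set η := μ₁.toSignedMeasure - μ₂.toSignedMeasure with hη
  have hw := sphereEnergy_toReal_pos hs hsd
  have hU := sigmaPotential_nonneg (d := d) (s := s) (R := R)
  have hc := uniformCharge_pos (d := d) (s := s) (R := R) hq
  have hp1 : ∀ x : Sph d, rieszPotential s μ₁ x =
      ENNReal.ofReal (uniformCharge d s q R) * sphereEnergy d s :=
    rieszPotential_smul_sigma hs hsd _
  have hp2 : ∀ x : Sph d, rieszPotential s μ₂ x = ENNReal.ofReal (externalField d R q s x) :=
    rieszPotential_fieldMeasure hR hs hsd hq
  have hadd := posPart_add_eq_negPart_add μ₁ μ₂ η hη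
  have hpos := posPart_le μ₁ μ₂ η hη
  have hfin : ∀ x : Sph d, rieszPotential s η.toJordanDecomposition.posPart x ≠ ∞ := fun x => by
    refine ne_top_of_le_ne_top ?_ (lintegral_mono' hpos le_rfl)
    change rieszPotential s μ₁ x ≠ ∞
    rw [hp1]
    exact ENNReal.mul_ne_top ENNReal.ofReal_ne_top (sphereEnergy_ne_top hs hsd)
  have hsum : ∀ x : Sph d, rieszPotential s η.toJordanDecomposition.posPart x +
      ENNReal.ofReal (externalField d R q s x) =
      rieszPotential s η.toJordanDecomposition.negPart x +
        ENNReal.ofReal (uniformCharge d s q R) * sphereEnergy d s := fun x => by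
    rw [← hp1 x, ← hp2 x, ← rieszPotential_add, ← rieszPotential_add, hadd]
  have hfin' : ∀ x : Sph d, rieszPotential s η.toJordanDecomposition.negPart x ≠ ∞ := fun x => by
    refine ne_top_of_le_ne_top ?_ ((hsum x).symm ▸ le_self_add)
    exact ENNReal.add_ne_top.2 ⟨hfin x, ENNReal.ofReal_ne_top⟩
  refine ⟨?_, fun x => ⟨hfin x, hfin' x⟩,
    uniformCharge d s q R * (sphereEnergy d s).toReal, fun x => ?_⟩
  · have h1 : μ₁.real Set.univ = uniformCharge d s q R := by
      simp [hμ₁, measureReal_def, ENNReal.toReal_ofReal hc.le]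
    rw [hη, sub_apply, Measure.toSignedMeasure_apply_measurable MeasurableSet.univ,
      Measure.toSignedMeasure_apply_measurable MeasurableSet.univ, h1, measureReal_def, hμ₂,
      fieldMeasure_univ hR hs hsd hq, ENNReal.toReal_ofReal (by positivity), uniformCharge]
    ring
  · have h1 := congrArg ENNReal.toReal (hsum x)
    rw [ENNReal.toReal_add (hfin x) ENNReal.ofReal_ne_top, ENNReal.toReal_add (hfin' x)
      (ENNReal.mul_ne_top ENNReal.ofReal_ne_top (sphereEnergy_ne_top hs hsd)),
      ENNReal.toReal_ofReal (externalField_nonneg hq _), ENNReal.toReal_mul,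
      ENNReal.toReal_ofReal hc.le] at h1
    linarith

/-- Uniqueness of the signed equilibrium. The sums `η⁺ + η'⁻` and `η'⁺ + η⁻` are positive measures of
equal mass whose potentials differ by a constant. -/
theorem IsSignedEquilibrium.eq (hs : 0 < s) (hsd : s < d) {Q : Space d → ℝ}
    {η η' : SignedMeasure (Sph d)} (h : IsSignedEquilibrium s Q η)
    (h' : IsSignedEquilibrium s Q η') : η = η' := by
  obtain ⟨hm, hf, G, hG⟩ := h
  obtain ⟨hm', hf', G', hG'⟩ := h'
  have key : η.toJordanDecomposition.posPart + η'.toJordanDecomposition.negPart =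
      η'.toJordanDecomposition.posPart + η.toJordanDecomposition.negPart := by
    refine measure_eq_of_rieszPotential_add_const hs hsd ?_
      (c₁ := ENNReal.ofReal (G' + (|G| + |G'|))) (c₂ := ENNReal.ofReal (G + (|G| + |G'|)))
      ENNReal.ofReal_ne_top (Filter.Eventually.of_forall fun x => ?_)
    · rw [η.apply_eq_posPart_real_sub_negPart_real MeasurableSet.univ] at hm
      rw [η'.apply_eq_posPart_real_sub_negPart_real MeasurableSet.univ] at hm'
      rw [← ENNReal.toReal_eq_toReal_iff' (measure_ne_top _ _) (measure_ne_top _ _)]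
      change Measure.real _ _ = Measure.real _ _
      rw [measureReal_add_apply, measureReal_add_apply]
      linarith
    · have e1 := hG x
      have e2 := hG' x
      have n1 : 0 ≤ G' + (|G| + |G'|) := by linarith [neg_abs_le G', abs_nonneg G]
      have n2 : 0 ≤ G + (|G| + |G'|) := by linarith [neg_abs_le G, abs_nonneg G']
      rw [rieszPotential_add, rieszPotential_add, ← ENNReal.toReal_eq_toReal_iff'
        (ENNReal.add_ne_top.2 ⟨ENNReal.add_ne_top.2 ⟨(hf x).1, (hf' x).2⟩, ENNReal.ofReal_ne_top⟩)
        (ENNReal.add_ne_top.2 ⟨ENNReal.add_ne_top.2 ⟨(hf' x).1, (hf x).2⟩, ENNReal.ofReal_ne_top⟩),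
        ENNReal.toReal_add (ENNReal.add_ne_top.2 ⟨(hf x).1, (hf' x).2⟩) ENNReal.ofReal_ne_top,
        ENNReal.toReal_add (ENNReal.add_ne_top.2 ⟨(hf' x).1, (hf x).2⟩) ENNReal.ofReal_ne_top,
        ENNReal.toReal_add (hf x).1 (hf' x).2, ENNReal.toReal_add (hf' x).1 (hf x).2,
        ENNReal.toReal_ofReal n1, ENNReal.toReal_ofReal n2]
      linarith
  ext A hA
  rw [η.apply_eq_posPart_real_sub_negPart_real hA, η'.apply_eq_posPart_real_sub_negPart_real hA]
  have h2 : (η.toJordanDecomposition.posPart + η'.toJordanDecomposition.negPart).real A =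
      (η'.toJordanDecomposition.posPart + η.toJordanDecomposition.negPart).real A := by rw [key]
  rw [measureReal_add_apply, measureReal_add_apply] at h2
  linarith

end Equilibrium

/-! ### Positivity of the signed equilibrium -/

section Positivity

variable {d : ℕ} {s q R : ℝ}

theorem fieldDensity_northPole (hR : 1 < R) (s q : ℝ) : fieldDensity d s q R (northPole d) =
    q / (sphereEnergy d s).toReal * ((R + 1) ^ ((d : ℝ) - s) / (R - 1) ^ d) := by
  have h1 : 0 < R - 1 := by linarith
  have h2 : 0 < R + 1 := by linarith
  rw [fieldDensity, kelvinDensity, norm_northPole_sub_source hR, norm_source hR,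
    show R ^ 2 - 1 = (R + 1) * (R - 1) by ring, Real.mul_rpow h2.le h1.le, mul_assoc,
    ← Real.rpow_add h1, show (d : ℝ) - s + (s - 2 * d) = -d by ring, Real.rpow_neg h1.le,
    Real.rpow_natCast, ← div_eq_mul_inv]

theorem fieldDensity_lt_northPole (hR : 1 < R) (hs : 0 < s) (hsd : s < d) (hq : 0 < q)
    {y : Sph d} (hy : y ≠ northPole d) :
    fieldDensity d s q R y < fieldDensity d s q R (northPole d) := by
  have hw := sphereEnergy_toReal_pos hs hsd
  have h0 : 0 < (‖source d R‖ ^ 2 - 1) ^ ((d : ℝ) - s) := by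
    rw [norm_source hR]
    exact Real.rpow_pos_of_pos (by nlinarith) _
  unfold fieldDensity kelvinDensity
  rw [norm_northPole_sub_source hR]
  refine mul_lt_mul_of_pos_left (mul_lt_mul_of_pos_left ?_ h0) (div_pos hq hw)
  exact Real.rpow_lt_rpow_of_neg (by linarith) (sub_one_lt_norm_sub_source hR hy) (by linarith)

theorem fieldDensity_le_northPole (hR : 1 < R) (hs : 0 < s) (hsd : s < d) (hq : 0 < q)
    (y : Sph d) : fieldDensity d s q R y ≤ fieldDensity d s q R (northPole d) := by
  rcases eq_or_ne y (northPole d) with rfl | hy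
  · exact le_rfl
  · exact (fieldDensity_lt_northPole hR hs hsd hq hy).le

theorem goncharA_eq (hR : 1 < R) (s q : ℝ) : goncharA d s q R = R ^ (d - 1) * (R - 1) ^ d *
    ((sphereEnergy d s).toReal / q + sigmaPotential d s R -
      (R + 1) ^ ((d : ℝ) - s) / (R - 1) ^ d) := by
  have h1 : (R - 1) ^ d ≠ 0 := pow_ne_zero _ (by linarith)
  rw [goncharA]
  field_simp
  ring

/-- The Gonchar function has the sign of the density of the signed equilibrium at the north pole. -/
theorem goncharA_nonneg_iff (hR : 1 < R) (hs : 0 < s) (hsd : s < d) (hq : 0 < q) :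
    0 ≤ goncharA d s q R ↔ fieldDensity d s q R (northPole d) ≤ uniformCharge d s q R := by
  have hw := sphereEnergy_toReal_pos hs hsd
  have h1 : 0 < R ^ (d - 1) * (R - 1) ^ d :=
    mul_pos (pow_pos (by linarith) _) (pow_pos (by linarith) _)
  have h2 : uniformCharge d s q R - fieldDensity d s q R (northPole d) =
      q / (sphereEnergy d s).toReal * ((sphereEnergy d s).toReal / q + sigmaPotential d s R -
      (R + 1) ^ ((d : ℝ) - s) / (R - 1) ^ d) := by
    rw [fieldDensity_northPole hR, uniformCharge]
    field_simp
  rw [goncharA_eq hR, mul_nonneg_iff_of_pos_left h1, ← sub_nonneg (b := fieldDensity _ _ _ _ _), h2,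
    mul_nonneg_iff_of_pos_left (div_pos hq hw)]

theorem fieldMeasure_le (hR : 1 < R) (hs : 0 < s) (hsd : s < d) (hq : 0 < q)
    (h : 0 ≤ goncharA d s q R) :
    fieldMeasure d s q R ≤ ENNReal.ofReal (uniformCharge d s q R) • sigma d := by
  rw [← withDensity_const]
  refine withDensity_mono (Filter.Eventually.of_forall fun y => ENNReal.ofReal_le_ofReal ?_)
  exact (fieldDensity_le_northPole hR hs hsd hq y).trans ((goncharA_nonneg_iff hR hs hsd hq).1 h)

theorem fieldMeasure_lt_of_isOpen (hR : 1 < R) (hs : 0 < s) (hsd : s < d) (hq : 0 < q)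
    (h : 0 ≤ goncharA d s q R) {V : Set (Sph d)} (hV : IsOpen V) (hne : V.Nonempty) :
    fieldMeasure d s q R V < (ENNReal.ofReal (uniformCharge d s q R) • sigma d) V := by
  have hd : 1 ≤ d := by
    have : (0 : ℝ) < d := hs.trans hsd
    exact_mod_cast this
  have := isFiniteMeasure_fieldMeasure hR hs hsd hq
  have h1 : fieldMeasure d s q R V = ∫⁻ y in V, ENNReal.ofReal (fieldDensity d s q R y) ∂sigma d :=
    withDensity_apply _ hV.measurableSet
  have h2 : ∀ᵐ y ∂sigma d, y ≠ northPole d := by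
    rw [ae_iff]
    simpa using sigma_singleton hd (northPole d)
  rw [Measure.smul_apply, smul_eq_mul, ← setLIntegral_const, h1]
  refine setLIntegral_strict_mono hV.measurableSet (hV.measure_ne_zero _ hne) measurable_const
    (h1 ▸ measure_ne_top _ _) ?_
  filter_upwards [h2] with y hy _
  refine (ENNReal.ofReal_lt_ofReal_iff (uniformCharge_pos hq)).2 ?_
  exact (fieldDensity_lt_northPole hR hs hsd hq hy).trans_le
    ((goncharA_nonneg_iff hR hs hsd hq).1 h)

/-- If the field density exceeds the uniform charge at the north pole, it does so nearby. -/
theorem goncharA_nonneg_of_fieldMeasure_le (hR : 1 < R) (hs : 0 < s) (hsd : s < d) (hq : 0 < q)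
    (h : ∀ V : Set (Sph d), IsOpen V →
      fieldMeasure d s q R V ≤ (ENNReal.ofReal (uniformCharge d s q R) • sigma d) V) :
    0 ≤ goncharA d s q R := by
  rw [goncharA_nonneg_iff hR hs hsd hq]
  by_contra hlt
  push Not at hlt
  set V : Set (Sph d) := {y | uniformCharge d s q R < fieldDensity d s q R y} with hV
  have hc := continuous_fieldDensity (d := d) hR s q
  have hVo : IsOpen V := isOpen_lt continuous_const hc
  have h1 : fieldMeasure d s q R V = ∫⁻ y in V, ENNReal.ofReal (fieldDensity d s q R y) ∂sigma d :=
    withDensity_apply _ hVo.measurableSet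
  refine (h V hVo).not_gt ?_
  rw [Measure.smul_apply, smul_eq_mul, ← setLIntegral_const, h1]
  refine setLIntegral_strict_mono hVo.measurableSet (hVo.measure_ne_zero _ ⟨_, hlt⟩)
    hc.measurable.ennreal_ofReal ?_ (Filter.Eventually.of_forall fun y hy => ?_)
  · rw [setLIntegral_const]
    exact ENNReal.mul_ne_top ENNReal.ofReal_ne_top (measure_ne_top _ _)
  · have hy : uniformCharge d s q R < fieldDensity d s q R y := hy
    exact (ENNReal.ofReal_lt_ofReal_iff ((uniformCharge_pos hq).trans hy)).2 hy

theorem isFiniteMeasure_ofReal_smul_sigma (c : ℝ) :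
    IsFiniteMeasure (ENNReal.ofReal c • sigma d) :=
  ⟨by simp⟩

theorem exists_isSignedEquilibrium (hR : 1 < R) (hs : 0 < s) (hsd : s < d) (hq : 0 < q) :
    ∃ η : SignedMeasure (Sph d), IsSignedEquilibrium s (externalField d R q s) η :=
  have := isFiniteMeasure_fieldMeasure hR hs hsd hq
  have := isFiniteMeasure_ofReal_smul_sigma (d := d) (uniformCharge d s q R)
  ⟨_, isSignedEquilibrium_sub hR hs hsd hq⟩

theorem IsSignedEquilibrium.apply_eq (hR : 1 < R) (hs : 0 < s) (hsd : s < d) (hq : 0 < q)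
    {η : SignedMeasure (Sph d)} (h : IsSignedEquilibrium s (externalField d R q s) η)
    {V : Set (Sph d)} (hV : MeasurableSet V) :
    η V = ((ENNReal.ofReal (uniformCharge d s q R) • sigma d) V).toReal -
      (fieldMeasure d s q R V).toReal := by
  have := isFiniteMeasure_fieldMeasure hR hs hsd hq
  have := isFiniteMeasure_ofReal_smul_sigma (d := d) (uniformCharge d s q R)
  rw [h.eq hs hsd (isSignedEquilibrium_sub hR hs hsd hq), sub_apply,
    Measure.toSignedMeasure_apply_measurable hV, Measure.toSignedMeasure_apply_measurable hV]
  rfl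

theorem IsSignedEquilibrium.nonneg_iff (hR : 1 < R) (hs : 0 < s) (hsd : s < d) (hq : 0 < q)
    {η : SignedMeasure (Sph d)} (h : IsSignedEquilibrium s (externalField d R q s) η) :
    0 ≤ η ↔ 0 ≤ goncharA d s q R := by
  have := isFiniteMeasure_fieldMeasure hR hs hsd hq
  have := isFiniteMeasure_ofReal_smul_sigma (d := d) (uniformCharge d s q R)
  constructor
  · intro hη
    refine goncharA_nonneg_of_fieldMeasure_le hR hs hsd hq fun V hV => ?_
    have h1 := hη V hV.measurableSet
    rw [h.apply_eq hR hs hsd hq hV.measurableSet] at h1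
    exact (ENNReal.toReal_le_toReal (measure_ne_top _ _) (measure_ne_top _ _)).1 (sub_nonneg.1 h1)
  · intro hΓ V hV
    rw [h.apply_eq hR hs hsd hq hV]
    exact sub_nonneg.2 (ENNReal.toReal_mono (measure_ne_top _ _)
      (fieldMeasure_le hR hs hsd hq hΓ V))

theorem IsSignedEquilibrium.pos_of_isOpen (hR : 1 < R) (hs : 0 < s) (hsd : s < d) (hq : 0 < q)
    {η : SignedMeasure (Sph d)} (h : IsSignedEquilibrium s (externalField d R q s) η)
    (hΓ : 0 ≤ goncharA d s q R) {V : Set (Sph d)} (hV : IsOpen V) (hne : V.Nonempty) : 0 < η V := by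
  have := isFiniteMeasure_ofReal_smul_sigma (d := d) (uniformCharge d s q R)
  rw [h.apply_eq hR hs hsd hq hV.measurableSet]
  exact sub_pos.2 (ENNReal.toReal_strict_mono (measure_ne_top _ _)
    (fieldMeasure_lt_of_isOpen hR hs hsd hq hΓ hV hne))

theorem weightedPotential_externalField (hR : 1 < R) (hs : 0 < s) (hsd : s < d) (hq : 0 < q)
    (μ : Measure (Sph d)) (x : Sph d) : weightedPotential s (externalField d R q s) μ x =
      rieszPotential s (μ + fieldMeasure d s q R) x := by
  rw [weightedPotential, rieszPotential_add, rieszPotential_fieldMeasure hR hs hsd hq]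

/-- When the Gonchar function is nonnegative, the signed equilibrium is an extremal measure of full
support. -/
theorem exists_isExtremal_support_eq_univ (hR : 1 < R) (hs : 0 < s) (hsd : s < d) (hq : 0 < q)
    (hΓ : 0 ≤ goncharA d s q R) : ∃ μ : ProbabilityMeasure (Sph d),
      IsExtremal s (externalField d R q s) μ ∧ (μ : Measure (Sph d)).support = Set.univ := by
  have := isFiniteMeasure_fieldMeasure hR hs hsd hq
  set μ := ENNReal.ofReal (uniformCharge d s q R) • sigma d - fieldMeasure d s q R with hμ
  have hadd : μ + fieldMeasure d s q R = ENNReal.ofReal (uniformCharge d s q R) • sigma d :=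
    Measure.sub_add_cancel_of_le (fieldMeasure_le hR hs hsd hq hΓ)
  have hp : IsProbabilityMeasure μ := by
    have h1 := congrArg (fun m : Measure (Sph d) => m Set.univ) hadd
    simp only [Measure.add_apply, Measure.smul_apply, measure_univ, smul_eq_mul, mul_one] at h1
    rw [← one_add_fieldMeasure_univ hR hs hsd hq] at h1
    exact ⟨(ENNReal.add_left_inj (measure_ne_top _ _)).1 h1⟩
  have hopen : μ.IsOpenPosMeasure := ⟨fun V hV hne h0 => by
    have h1 := fieldMeasure_lt_of_isOpen hR hs hsd hq hΓ hV hne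
    rw [← hadd, Measure.add_apply, h0, zero_add] at h1
    exact h1.false⟩
  refine ⟨⟨μ, hp⟩, isExtremal_of_weightedPotential_eq hs (continuous_externalField hR q s)
    (fun x => externalField_nonneg hq _)
    (G := ENNReal.ofReal (uniformCharge d s q R) * sphereEnergy d s)
    (ENNReal.mul_ne_top ENNReal.ofReal_ne_top (sphereEnergy_ne_top hs hsd)) (fun x => ?_),
    Measure.support_eq_univ (μ := μ)⟩
  rw [weightedPotential_externalField hR hs hsd hq, ProbabilityMeasure.coe_mk, hadd,
    rieszPotential_smul_sigma hs hsd]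

/-- An extremal measure of full support is the signed equilibrium, which is then positive. -/
theorem goncharA_nonneg_of_isExtremal (hR : 1 < R) (hs : 0 < s) (hsd : s < d) (hq : 0 < q)
    {μ : ProbabilityMeasure (Sph d)} (h : IsExtremal s (externalField d R q s) μ)
    (hsupp : (μ : Measure (Sph d)).support = Set.univ) : 0 ≤ goncharA d s q R := by
  have := isFiniteMeasure_fieldMeasure hR hs hsd hq
  have := isFiniteMeasure_ofReal_smul_sigma (d := d) (uniformCharge d s q R)
  obtain ⟨B, -, hB⟩ := ae_weightedPotential_eq_of_isExtremal hs hsd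
    (continuous_externalField hR q s) (fun x => externalField_nonneg hq _) h hsupp
  have heq : (μ : Measure (Sph d)) + fieldMeasure d s q R =
      ENNReal.ofReal (uniformCharge d s q R) • sigma d := by
    refine measure_eq_of_rieszPotential_add_const hs hsd ?_ (c₂ := B)
      (c₁ := ENNReal.ofReal (uniformCharge d s q R) * sphereEnergy d s)
      (ENNReal.mul_ne_top ENNReal.ofReal_ne_top (sphereEnergy_ne_top hs hsd)) ?_
    · simp [one_add_fieldMeasure_univ hR hs hsd hq]
    · filter_upwards [hB] with x hx
      rw [weightedPotential_externalField hR hs hsd hq] at hx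
      rw [hx, rieszPotential_smul_sigma hs hsd, add_comm]
  refine goncharA_nonneg_of_fieldMeasure_le hR hs hsd hq fun V _ => ?_
  rw [← heq]
  exact Measure.le_add_left le_rfl V

theorem infDist_source (hR : 1 < R) :
    Metric.infDist (source d R) (Metric.sphere (0 : Space d) 1) = R - 1 := by
  have hmem : (northPole d : Space d) ∈ Metric.sphere (0 : Space d) 1 := (northPole d).2
  refine le_antisymm ?_ ((Metric.le_infDist ⟨_, hmem⟩).2 fun y hy => ?_)
  · refine (Metric.infDist_le_dist_of_mem hmem).trans_eq ?_
    rw [dist_comm, dist_eq_norm, norm_northPole_sub_source hR]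
  · rw [dist_comm, dist_eq_norm]
    exact sub_one_le_norm_sub_source hR ⟨y, hy⟩

theorem mem_fullSupportDistances_iff (hs : 0 < s) (hsd : s < d) (hq : 0 < q) {ρ : ℝ} :
    ρ ∈ fullSupportDistances d s q ↔ ∃ R, 1 < R ∧ ρ = R - 1 ∧ 0 ≤ goncharA d s q R := by
  refine exists_congr fun R => and_congr_right fun hR => ?_
  rw [infDist_source hR]
  exact and_congr_right fun _ => ⟨fun ⟨μ, h1, h2⟩ => goncharA_nonneg_of_isExtremal hR hs hsd hq h1 h2,
    exists_isExtremal_support_eq_univ hR hs hsd hq⟩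

end Positivity

/-! ### The potential of the sphere measure as a function of the radius -/

section Radial

variable {d : ℕ} {s q p R : ℝ}

/-- The integral `∫ (R + R⁻¹ - 2⟪y, n⟫)^{-p} dσ(y)`, where `n` is the north pole. -/
def radialIntegral (d : ℕ) (p R : ℝ) : ℝ :=
  2 ^ (-p) * stieltjes (sigma d) (fun y : Sph d => ⟪(y : Space d), (northPole d : Space d)⟫) p
    ((R + R⁻¹) / 2)

theorem one_lt_joukowski (hR : 1 < R) : 1 < (R + R⁻¹) / 2 := by
  have h0 : 0 < R := by linarith
  have h1 : (R + R⁻¹) / 2 - 1 = (R - 1) ^ 2 / (2 * R) := by field_simp; ring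
  have h2 : 0 < (R - 1) ^ 2 / (2 * R) := by
    have : 0 < R - 1 := by linarith
    positivity
  linarith

theorem inner_northPole_le_one (y : Sph d) : ⟪(y : Space d), (northPole d : Space d)⟫ ≤ 1 := by
  have h := real_inner_le_norm (y : Space d) (northPole d)
  rwa [norm_northPole, mul_one, show ‖(y : Space d)‖ = 1 by simp] at h

theorem integral_norm_sub_source_rpow (d : ℕ) (s : ℝ) (hR : 1 < R) :
    ∫ y : Sph d, ‖(y : Space d) - source d R‖ ^ (-s) ∂sigma d =
      R ^ (-(s / 2)) * radialIntegral d (s / 2) R := by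
  have h0 : 0 < R := by linarith
  rw [radialIntegral, ← mul_assoc, ← Real.mul_rpow h0.le zero_le_two, mul_comm R 2, stieltjes,
    ← integral_const_mul]
  refine integral_congr_ae (Filter.Eventually.of_forall fun y => ?_)
  dsimp only
  rw [source_eq]
  refine norm_sub_smul_rpow h0 ?_ (one_lt_joukowski hR) (by simp) norm_northPole
  field_simp

theorem sigmaPotential_eq_integral (d : ℕ) (s : ℝ) (hR : 1 < R) :
    sigmaPotential d s R = ∫ y : Sph d, ‖(y : Space d) - source d R‖ ^ (-s) ∂sigma d := by
  rw [sigmaPotential, rieszPotential_sigma_source hR, integral_eq_lintegral_of_nonneg_ae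
    (Filter.Eventually.of_forall fun y => Real.rpow_nonneg (norm_nonneg _) _)
    (continuous_norm_sub_source_rpow hR _).aestronglyMeasurable]

/-- The Kelvin transform exchanges the exponents `s` and `2 d - s`. -/
theorem sigmaPotential_eq_integral_kelvinDensity (d : ℕ) (s : ℝ) (hR : 1 < R) :
    sigmaPotential d s R = (R ^ 2 - 1) ^ ((d : ℝ) - s) *
      ∫ y : Sph d, ‖(y : Space d) - source d R‖ ^ (s - 2 * d) ∂sigma d := by
  have h0 : 0 ≤ R ^ 2 - 1 := by nlinarith
  rw [sigmaPotential, ← lintegral_kelvinDensity s (one_lt_norm_source hR),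
    ← integral_eq_lintegral_of_nonneg_ae, ← integral_const_mul]
  · simp only [kelvinDensity, norm_source hR]
  · refine Filter.Eventually.of_forall fun y => ?_
    simp only [kelvinDensity, norm_source hR]
    positivity
  · unfold kelvinDensity
    exact ((continuous_norm_sub_source_rpow hR _).const_mul _).aestronglyMeasurable

theorem hasDerivAt_radialIntegral (hp : 0 ≤ p) (hR : 1 < R) :
    HasDerivAt (radialIntegral d p) (-p * (1 - (R ^ 2)⁻¹) * radialIntegral d (p + 1) R) R := by
  have h0 : R ≠ 0 := by linarith
  have h1 : HasDerivAt (fun R : ℝ => (R + R⁻¹) / 2) ((1 + -(R ^ 2)⁻¹) / 2) R :=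
    ((hasDerivAt_id R).add (hasDerivAt_inv h0)).div_const 2
  have h2 := hasDerivAt_stieltjes (ν := sigma d)
    (t := fun y : Sph d => ⟪(y : Space d), (northPole d : Space d)⟫) (by fun_prop)
    inner_northPole_le_one hp (one_lt_joukowski hR)
  have h3 := (h2.comp R h1).const_mul ((2 : ℝ) ^ (-p))
  refine h3.congr_deriv ?_
  rw [radialIntegral, neg_add, Real.rpow_add two_pos, Real.rpow_neg_one]
  ring

theorem continuousOn_sigmaPotential (d : ℕ) (hs : 0 < s) :
    ContinuousOn (sigmaPotential d s) (Set.Ioi 1) := by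
  have h1 : ContinuousOn (fun R : ℝ => R ^ (-(s / 2)) * radialIntegral d (s / 2) R) (Set.Ioi 1) := by
    intro R hR
    have hR : 1 < R := hR
    exact ((Real.continuousAt_rpow_const _ _ (Or.inl (by linarith))).mul
      (hasDerivAt_radialIntegral (by positivity) hR).continuousAt).continuousWithinAt
  refine h1.congr fun R hR => ?_
  rw [sigmaPotential_eq_integral d s hR, integral_norm_sub_source_rpow d s hR]

theorem sigmaPotential_le_sphereEnergy (hs : 0 < s) (hsd : s < d) (hR : 1 < R) :
    sigmaPotential d s R ≤ (sphereEnergy d s).toReal := by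
  refine ENNReal.toReal_mono (sphereEnergy_ne_top hs hsd) ?_
  rw [← rieszPotential_sigma_eq_sphereEnergy hs hsd (northPole d), rieszPotential_sigma_source hR]
  refine lintegral_mono fun y => ?_
  dsimp only
  have hn : (0 : ℝ) < ‖(y : Space d) - source d R‖ := by
    linarith [sub_one_le_norm_sub_source hR y]
  rw [← ENNReal.ofReal_rpow_of_pos hn, ENNReal.rpow_neg, ENNReal.rpow_neg, edist_comm, edist_dist,
    dist_eq_norm]
  refine ENNReal.inv_le_inv.2 (ENNReal.rpow_le_rpow (ENNReal.ofReal_le_ofReal ?_) hs.le)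
  refine le_of_sq_le_sq ?_ hn.le
  rw [norm_sub_source_sq]
  nlinarith [sq_nonneg (R - 1), sq_nonneg ‖(y : Space d) - northPole d‖]

/-! ### The zero of the Gonchar function -/

/-- `(R + 1)^{d - s} / (R - 1)^d - U_s^σ(R)`: the Gonchar function vanishes where this equals
`W_s / q`. -/
def criticalRatio (d : ℕ) (s R : ℝ) : ℝ :=
  (R + 1) ^ ((d : ℝ) - s) / (R - 1) ^ d - sigmaPotential d s R

/-- By the Kelvin transform, `criticalRatio` is a product of a decreasing function and the mean of
a function that decreases in `R` pointwise. -/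
theorem criticalRatio_eq (d : ℕ) (s : ℝ) (hR : 1 < R) : criticalRatio d s R =
    (R + 1) ^ ((d : ℝ) - s) / (R - 1) ^ d *
      (1 - ∫ y : Sph d, ((R - 1) / ‖(y : Space d) - source d R‖) ^ (2 * d - s) ∂sigma d) := by
  have h1 : 0 < R - 1 := by linarith
  have h2 : 0 < R + 1 := by linarith
  have h3 : ∀ y : Sph d, ((R - 1) / ‖(y : Space d) - source d R‖) ^ (2 * d - s) =
      (R - 1) ^ (2 * d - s) * ‖(y : Space d) - source d R‖ ^ (s - 2 * d) := fun y => by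
    rw [Real.div_rpow h1.le (norm_nonneg _), ← neg_sub (2 * (d : ℝ)) s,
      Real.rpow_neg (norm_nonneg _), div_eq_mul_inv]
  simp only [h3]
  rw [integral_const_mul, criticalRatio, sigmaPotential_eq_integral_kelvinDensity d s hR, mul_sub,
    mul_one, ← mul_assoc]
  congr 2
  rw [show R ^ 2 - 1 = (R + 1) * (R - 1) by ring, Real.mul_rpow h2.le h1.le,
    show (2 * (d : ℝ) - s) = (d - s) + d by ring, Real.rpow_add h1, Real.rpow_natCast]
  field_simp

theorem criticalRatio_lt_of_pos (hs : 0 < s) (hsd : s < d) {R₁ R₂ : ℝ} (h1 : 1 < R₁)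
    (h12 : R₁ < R₂) (hpos : 0 < criticalRatio d s R₂) :
    criticalRatio d s R₂ < criticalRatio d s R₁ := by
  have h2 : 1 < R₂ := h1.trans h12
  have he : 0 < 2 * (d : ℝ) - s := by linarith
  have hP : ∀ R : ℝ, 1 < R → (R + 1) ^ ((d : ℝ) - s) / (R - 1) ^ d =
      ((R + 1) / (R - 1)) ^ d * (R + 1) ^ (-s) := fun R hR => by
    have h3 : 0 < R + 1 := by linarith
    rw [sub_eq_add_neg, Real.rpow_add h3, Real.rpow_natCast, div_pow]
    ring
  have hPpos : ∀ R : ℝ, 1 < R → 0 < (R + 1) ^ ((d : ℝ) - s) / (R - 1) ^ d := fun R hR => by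
    have h3 : 0 < R + 1 := by linarith
    have h4 : 0 < R - 1 := by linarith
    positivity
  have hPlt : (R₂ + 1) ^ ((d : ℝ) - s) / (R₂ - 1) ^ d < (R₁ + 1) ^ ((d : ℝ) - s) / (R₁ - 1) ^ d := by
    rw [hP _ h1, hP _ h2]
    have a1 : 0 < R₁ - 1 := by linarith
    have a2 : 0 < R₂ - 1 := by linarith
    have a3 : 0 < R₁ + 1 := by linarith
    have a4 : 0 < R₂ + 1 := by linarith
    refine mul_lt_mul' (pow_le_pow_left₀ (by positivity) ?_ d)
      (Real.rpow_lt_rpow_of_neg a3 (by linarith) (by linarith)) (by positivity) (by positivity)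
    rw [div_le_div_iff₀ a2 a1]
    nlinarith
  have hint : ∀ R : ℝ, 1 < R → Integrable
      (fun y : Sph d => ((R - 1) / ‖(y : Space d) - source d R‖) ^ (2 * d - s)) (sigma d) := by
    intro R hR
    have hc : Continuous fun y : Sph d =>
        ((R - 1) / ‖(y : Space d) - source d R‖) ^ (2 * d - s) := by
      refine Continuous.rpow_const (Continuous.div continuous_const (by fun_prop) fun y => ?_)
        fun y => Or.inr he.le
      linarith [sub_one_le_norm_sub_source hR y]
    exact hc.integrable_of_hasCompactSupport (HasCompactSupport.of_compactSpace _)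
  have hmono : ∫ y : Sph d, ((R₁ - 1) / ‖(y : Space d) - source d R₁‖) ^ (2 * d - s) ∂sigma d ≤
      ∫ y : Sph d, ((R₂ - 1) / ‖(y : Space d) - source d R₂‖) ^ (2 * d - s) ∂sigma d := by
    refine integral_mono (hint _ h1) (hint _ h2) fun y => ?_
    have b1 : 0 < R₁ - 1 := by linarith
    have b2 : 0 < R₂ - 1 := by linarith
    have n1 : 0 < ‖(y : Space d) - source d R₁‖ := b1.trans_le (sub_one_le_norm_sub_source h1 y)
    have n2 : 0 < ‖(y : Space d) - source d R₂‖ := b2.trans_le (sub_one_le_norm_sub_source h2 y)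
    refine Real.rpow_le_rpow (by positivity) ?_ he.le
    rw [div_le_div_iff₀ n1 n2]
    refine le_of_sq_le_sq ?_ (by positivity)
    rw [mul_pow, mul_pow, norm_sub_source_sq, norm_sub_source_sq]
    have hδ := sq_nonneg ‖(y : Space d) - northPole d‖
    have hk : 0 ≤ (R₂ - R₁) * (R₁ * R₂ - 1) := mul_nonneg (by linarith) (by nlinarith)
    nlinarith [mul_nonneg hk hδ]
  rw [criticalRatio_eq d s h2] at hpos ⊢
  rw [criticalRatio_eq d s h1]
  have hI2 := pos_of_mul_pos_right hpos (hPpos _ h2).le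
  exact mul_lt_mul hPlt (by linarith) hI2 (hPpos _ h1).le

theorem exists_criticalRatio_eq (hs : 0 < s) (hsd : s < d) {C : ℝ} (hC : 0 < C) :
    ∃ R : ℝ, 1 < R ∧ criticalRatio d s R = C := by
  have hcont : ContinuousOn (criticalRatio d s) (Set.Ioi 1) := by
    refine ContinuousOn.sub (ContinuousOn.div ?_ (by fun_prop) fun R hR => ?_)
      (continuousOn_sigmaPotential d hs)
    · exact ContinuousOn.rpow_const (by fun_prop) fun R hR => Or.inr (by linarith)
    · have hR : 1 < R := hR
      exact pow_ne_zero _ (by linarith)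
  have hd : 1 ≤ d := by
    have : (0 : ℝ) < d := hs.trans hsd
    exact_mod_cast this
  set w := (sphereEnergy d s).toReal with hw
  have hw0 : 0 < w := sphereEnergy_toReal_pos hs hsd
  -- Near the sphere the first term is at least `(R - 1)⁻¹` and the potential is at most `w`.
  have hnear : ∃ R₁ : ℝ, 1 < R₁ ∧ C ≤ criticalRatio d s R₁ := by
    refine ⟨1 + (C + w + 1)⁻¹, by linarith [inv_pos.2 (show 0 < C + w + 1 by linarith)], ?_⟩
    set ε := (C + w + 1)⁻¹ with hε
    have hε0 : 0 < ε := inv_pos.2 (by linarith)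
    have hε1 : ε ≤ 1 := inv_le_one_of_one_le₀ (by linarith)
    have hU := sigmaPotential_le_sphereEnergy hs hsd (R := 1 + ε) (by linarith)
    have h1 : (1 : ℝ) ≤ (1 + ε + 1) ^ ((d : ℝ) - s) :=
      Real.one_le_rpow (by linarith) (by linarith)
    have h2 : (1 + ε - 1) ^ d ≤ ε := by
      rw [add_sub_cancel_left]
      exact pow_le_of_le_one hε0.le hε1 (by omega)
    have h3 : C + w + 1 ≤ (1 + ε + 1) ^ ((d : ℝ) - s) / (1 + ε - 1) ^ d := by
      rw [← inv_inv (C + w + 1), ← hε, ← one_div]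
      exact div_le_div₀ (by linarith) h1 (by simpa using pow_pos hε0 d) h2
    rw [criticalRatio]
    linarith
  have hfar : ∃ R₂ : ℝ, 1 < R₂ ∧ criticalRatio d s R₂ ≤ C := by
    have ht : Filter.Tendsto (fun R : ℝ => 2 ^ d * (R + 1) ^ (-s)) Filter.atTop (nhds 0) := by
      have := ((tendsto_rpow_neg_atTop hs).comp
        (Filter.tendsto_atTop_add_const_right _ (1 : ℝ) Filter.tendsto_id)).const_mul ((2 : ℝ) ^ d)
      simpa using this
    obtain ⟨R, hR, hR3⟩ := ((ht.eventually_lt_const hC).and (Filter.eventually_ge_atTop 3)).exists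
    refine ⟨R, by linarith, ?_⟩
    have h1 : 0 < R - 1 := by linarith
    have h2 : 0 < R + 1 := by linarith
    have h3 : (R + 1) ^ ((d : ℝ) - s) / (R - 1) ^ d ≤ 2 ^ d * (R + 1) ^ (-s) := by
      rw [sub_eq_add_neg, Real.rpow_add h2, Real.rpow_natCast, div_le_iff₀ (by positivity),
        mul_right_comm, ← mul_pow]
      gcongr
      linarith
    have := sigmaPotential_nonneg (d := d) (s := s) (R := R)
    rw [criticalRatio]
    linarith
  obtain ⟨R₁, h1, hR1⟩ := hnear
  obtain ⟨R₂, h2, hR2⟩ := hfar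
  obtain ⟨R, hR, hRC⟩ := isPreconnected_Ioi.intermediate_value (show R₂ ∈ Set.Ioi (1 : ℝ) from h2)
    (show R₁ ∈ Set.Ioi (1 : ℝ) from h1) hcont ⟨hR2, hR1⟩
  exact ⟨R, hR, hRC⟩

/-- The Gonchar function has a single zero, beyond which it is positive. -/
theorem exists_goncharA_zero (hs : 0 < s) (hsd : s < d) (hq : 0 < q) :
    ∃ Rq : ℝ, 1 < Rq ∧ ∀ R : ℝ, 1 < R →
      (goncharA d s q R = 0 ↔ R = Rq) ∧ (0 ≤ goncharA d s q R ↔ Rq ≤ R) := by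
  have hC : 0 < (sphereEnergy d s).toReal / q := div_pos (sphereEnergy_toReal_pos hs hsd) hq
  obtain ⟨Rq, hRq, hval⟩ := exists_criticalRatio_eq hs hsd hC
  refine ⟨Rq, hRq, fun R hR => ?_⟩
  have hpos : 0 < R ^ (d - 1) * (R - 1) ^ d :=
    mul_pos (pow_pos (by linarith) _) (pow_pos (by linarith) _)
  have hΓ : goncharA d s q R =
      R ^ (d - 1) * (R - 1) ^ d * (criticalRatio d s Rq - criticalRatio d s R) := by
    rw [goncharA_eq hR, hval, criticalRatio]
    ring
  rw [hΓ, mul_eq_zero_iff_left hpos.ne', mul_nonneg_iff_of_pos_left hpos, sub_nonneg]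
  rcases lt_trichotomy R Rq with h | rfl | h
  · have := criticalRatio_lt_of_pos hs hsd hR h (hval ▸ hC)
    exact ⟨⟨fun h' => by linarith, fun h' => by linarith⟩,
      ⟨fun h' => by linarith, fun h' => by linarith⟩⟩
  · simp
  · have hlt : criticalRatio d s R < criticalRatio d s Rq := by
      rcases le_or_gt (criticalRatio d s R) 0 with h0 | h0
      · linarith [hval ▸ hC]
      · exact criticalRatio_lt_of_pos hs hsd hRq h h0
    exact ⟨⟨fun h' => by linarith, fun h' => by linarith⟩, ⟨fun _ => h.le, fun _ => hlt.le⟩⟩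

end Radial

/-! ### The polynomial case -/

section Polynomial

variable {d : ℕ} {s q p R : ℝ}

theorem eq_of_hasDerivAt_zero_of_tendsto {f : ℝ → ℝ} {L : ℝ}
    (h : ∀ R : ℝ, 1 < R → HasDerivAt f 0 R) (hL : Filter.Tendsto f Filter.atTop (nhds L))
    (hR : 1 < R) : f R = L := by
  have hconst : ∀ x ∈ Set.Ioi (1 : ℝ), f x = f R := fun x hx =>
    isOpen_Ioi.is_const_of_deriv_eq_zero isPreconnected_Ioi
      (fun y hy => (h y hy).differentiableAt.differentiableWithinAt)
      (fun y hy => (h y hy).deriv) hx hR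
  refine tendsto_nhds_unique (tendsto_const_nhds.congr' ?_) hL
  filter_upwards [Filter.eventually_gt_atTop 1] with x hx using (hconst x hx).symm

theorem radialIntegral_eq (d : ℕ) (p : ℝ) (hR : 1 < R) : radialIntegral d p R =
    R ^ p * ∫ y : Sph d, ‖(y : Space d) - source d R‖ ^ (-(2 * p)) ∂sigma d := by
  have h0 : 0 < R := by linarith
  rw [integral_norm_sub_source_rpow d (2 * p) hR, ← mul_assoc, ← Real.rpow_add h0,
    mul_div_cancel_left₀ _ (two_ne_zero' ℝ), add_neg_cancel, Real.rpow_zero, one_mul]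

theorem norm_sub_source_le (hR : 1 < R) (y : Sph d) : ‖(y : Space d) - source d R‖ ≤ R + 1 := by
  refine (norm_sub_le _ _).trans ?_
  rw [norm_source hR, show ‖(y : Space d)‖ = 1 by simp, add_comm]

theorem tendsto_rpow_mul_radialIntegral (d : ℕ) (hp : 0 ≤ p) :
    Filter.Tendsto (fun R => R ^ p * radialIntegral d p R) Filter.atTop (nhds 1) := by
  have hlim : ∀ c : ℝ, Filter.Tendsto (fun R : ℝ => (1 + c * R⁻¹) ^ (-(2 * p))) Filter.atTop
      (nhds 1) := fun c => by
    have h1 : Filter.Tendsto (fun R : ℝ => 1 + c * R⁻¹) Filter.atTop (nhds 1) := by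
      simpa using (tendsto_inv_atTop_zero.const_mul c).const_add (1 : ℝ)
    have h2 := h1.rpow_const (p := -(2 * p)) (Or.inl one_ne_zero)
    simpa using h2
  refine tendsto_of_tendsto_of_tendsto_of_le_of_le' (hlim 1) (hlim (-1)) ?_ ?_ <;>
    filter_upwards [Filter.eventually_gt_atTop 1] with R hR
  all_goals
    have h0 : 0 < R := by linarith
    have hpow : R ^ p * radialIntegral d p R = R ^ (2 * p) *
        ∫ y : Sph d, ‖(y : Space d) - source d R‖ ^ (-(2 * p)) ∂sigma d := by
      rw [radialIntegral_eq d p hR, ← mul_assoc, ← Real.rpow_add h0, two_mul]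
    have hc : ∀ c : ℝ, 0 < R + c →
        R ^ (2 * p) * (R + c) ^ (-(2 * p)) = (1 + c * R⁻¹) ^ (-(2 * p)) := fun c hc => by
      have h3 : R + c = R * (1 + c * R⁻¹) := by field_simp
      have h4 : 0 < 1 + c * R⁻¹ := pos_of_mul_pos_right (h3 ▸ hc) h0.le
      rw [h3, Real.mul_rpow h0.le h4.le, ← mul_assoc, ← Real.rpow_add h0, add_neg_cancel,
        Real.rpow_zero, one_mul]
    rw [hpow, ← hc _ (by linarith)]
    refine mul_le_mul_of_nonneg_left ?_ (by positivity)
  · have h1 : ∫ _ : Sph d, (R + 1) ^ (-(2 * p)) ∂sigma d = (R + 1) ^ (-(2 * p)) := by simp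
    rw [← h1]
    refine integral_mono (integrable_const _) (integrable_norm_sub_source_rpow hR _) fun y => ?_
    exact Real.rpow_le_rpow_of_nonpos (by linarith [sub_one_le_norm_sub_source hR y])
      (norm_sub_source_le hR y) (by linarith)
  · have h1 : ∫ _ : Sph d, (R + -1) ^ (-(2 * p)) ∂sigma d = (R + -1) ^ (-(2 * p)) := by simp
    rw [← h1]
    refine integral_mono (integrable_norm_sub_source_rpow hR _) (integrable_const _) fun y => ?_
    exact Real.rpow_le_rpow_of_nonpos (by linarith) (sub_one_le_norm_sub_source hR y)
      (by linarith)

theorem tendsto_radialIntegral_zero (d : ℕ) (hp : 0 < p) :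
    Filter.Tendsto (radialIntegral d p) Filter.atTop (nhds 0) := by
  have h := (tendsto_rpow_neg_atTop hp).mul (tendsto_rpow_mul_radialIntegral d hp.le)
  rw [zero_mul] at h
  refine h.congr' ?_
  filter_upwards [Filter.eventually_gt_atTop 0] with R hR
  rw [← mul_assoc, ← Real.rpow_add hR, neg_add_cancel, Real.rpow_zero, one_mul]

/-- In the harmonic case `s = d - 1` the Kelvin transform relates the kernels of exponents `s` and
`s + 2`. -/
theorem radialIntegral_harmonic (d : ℕ) (hR : 1 < R) : radialIntegral d (((d : ℝ) - 1) / 2) R =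
    (R - R⁻¹) * radialIntegral d (((d : ℝ) - 1) / 2 + 1) R := by
  have h0 : 0 < R := by linarith
  have h1 := sigmaPotential_eq_integral_kelvinDensity d ((d : ℝ) - 1) hR
  rw [sigmaPotential_eq_integral d _ hR, sub_sub_cancel, Real.rpow_one] at h1
  rw [radialIntegral_eq d _ hR, radialIntegral_eq d _ hR,
    show -(2 * (((d : ℝ) - 1) / 2)) = -((d : ℝ) - 1) by ring, h1,
    show -(2 * (((d : ℝ) - 1) / 2 + 1)) = (d : ℝ) - 1 - 2 * d by ring, Real.rpow_add h0,
    Real.rpow_one]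
  field_simp

theorem radialIntegral_harmonic_eq_rpow (hd : 1 ≤ d) (hR : 1 < R) :
    radialIntegral d (((d : ℝ) - 1) / 2) R = R ^ (-(((d : ℝ) - 1) / 2)) := by
  set p := ((d : ℝ) - 1) / 2 with hp
  have hp0 : 0 ≤ p := by
    have : (1 : ℝ) ≤ d := by exact_mod_cast hd
    rw [hp]; linarith
  have h0 : 0 < R := by linarith
  have key : R ^ p * radialIntegral d p R = 1 := by
    refine eq_of_hasDerivAt_zero_of_tendsto (f := fun R => R ^ p * radialIntegral d p R)
      (fun r hr => ?_) (tendsto_rpow_mul_radialIntegral d hp0) hR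
    have hr0 : 0 < r := by linarith
    have h1 := (Real.hasDerivAt_rpow_const (x := r) (p := p) (Or.inl hr0.ne')).mul
      (hasDerivAt_radialIntegral (d := d) hp0 hr)
    refine h1.congr_deriv ?_
    rw [radialIntegral_harmonic d hr, ← hp, Real.rpow_sub_one hr0.ne']
    field_simp
    ring
  rw [Real.rpow_neg h0.le]
  exact eq_inv_of_mul_eq_one_right key

/-- Descent from the harmonic case: each integration lowers the exponent by two and adds one term.
All exponents of `R` stay negative as long as the exponent of the kernel is positive, so that
neither a logarithm nor a constant of integration arises. -/
theorem exists_radialIntegral_eq_sum (hd : 1 ≤ d) (m : ℕ) (hm : (m : ℝ) < ((d : ℝ) - 1) / 2) :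
    ∃ c : ℕ → ℝ, ∀ R : ℝ, 1 < R → radialIntegral d (((d : ℝ) - 1) / 2 - m) R =
      ∑ j ∈ Finset.range (m + 1), c j * R ^ (2 * j - ((d : ℝ) - 1) / 2 - m) := by
  set p := ((d : ℝ) - 1) / 2 with hp
  induction m with
  | zero =>
    refine ⟨fun _ => 1, fun R hR => ?_⟩
    simpa using radialIntegral_harmonic_eq_rpow hd hR
  | succ m ih =>
    push_cast at hm ⊢
    obtain ⟨c, hc⟩ := ih (by linarith)
    set r := p - (m + 1) with hr
    have hr0 : 0 < r := by linarith
    set e : ℕ → ℝ := fun j => 2 * j - p - (m + 1) with he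
    have hej : ∀ j ∈ Finset.range (m + 2), e j < 0 := fun j hj => by
      have : (j : ℝ) ≤ m + 1 := by exact_mod_cast Nat.lt_succ_iff.1 (Finset.mem_range.1 hj)
      simp only [he]
      linarith
    -- `-r * b j` is the coefficient of `R ^ (e j - 1)` in the derivative.
    set b : ℕ → ℝ := fun j => (if j = 0 then 0 else c (j - 1)) - (if j ≤ m then c j else 0) with hb
    refine ⟨fun j => -r * b j / e j, fun R hR => ?_⟩
    set F : ℝ → ℝ := fun R => ∑ j ∈ Finset.range (m + 2), -r * b j / e j * R ^ e j with hF
    have hFt : Filter.Tendsto F Filter.atTop (nhds 0) := by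
      have : Filter.Tendsto F Filter.atTop
          (nhds (∑ j ∈ Finset.range (m + 2), -r * b j / e j * 0)) := by
        refine tendsto_finsetSum _ fun j hj => Filter.Tendsto.const_mul _ ?_
        have := tendsto_rpow_neg_atTop (neg_pos.2 (hej j hj))
        rwa [neg_neg] at this
      simpa using this
    have hsum : ∀ x : ℝ, 0 < x → (1 - (x ^ 2)⁻¹) *
        ∑ j ∈ Finset.range (m + 1), c j * x ^ (2 * j - p - m) =
        ∑ j ∈ Finset.range (m + 2), b j * x ^ (e j - 1) := by
      intro x hx
      have h1 : ∑ j ∈ Finset.range (m + 2), (if j = 0 then 0 else c (j - 1)) * x ^ (e j - 1) =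
          ∑ j ∈ Finset.range (m + 1), c j * x ^ (2 * j - p - m) := by
        rw [Finset.sum_range_succ']
        simp only [Nat.add_eq_zero_iff, one_ne_zero, and_false, if_false, if_true, zero_mul,
          add_zero, Nat.add_sub_cancel]
        refine Finset.sum_congr rfl fun j _ => ?_
        congr 2
        simp only [he]
        push_cast
        ring
      have h2 : ∑ j ∈ Finset.range (m + 2), (if j ≤ m then c j else 0) * x ^ (e j - 1) =
          (x ^ 2)⁻¹ * ∑ j ∈ Finset.range (m + 1), c j * x ^ (2 * j - p - m) := by
        rw [Finset.sum_range_succ, if_neg (by omega), zero_mul, add_zero, Finset.mul_sum]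
        refine Finset.sum_congr rfl fun j hj => ?_
        rw [if_pos (Nat.lt_succ_iff.1 (Finset.mem_range.1 hj)), mul_left_comm]
        congr 1
        rw [← Real.rpow_natCast, ← Real.rpow_neg hx.le, ← Real.rpow_add hx]
        congr 1
        simp only [he]
        push_cast
        ring
      simp only [hb, sub_mul, Finset.sum_sub_distrib, h1, h2, one_mul]
    have hFd : ∀ x : ℝ, 1 < x → HasDerivAt F (-r * ((1 - (x ^ 2)⁻¹) *
        ∑ j ∈ Finset.range (m + 1), c j * x ^ (2 * j - p - m))) x := by
      intro x hx
      have hx0 : 0 < x := by linarith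
      rw [hsum x hx0, Finset.mul_sum]
      refine HasDerivAt.fun_sum fun j hj => ?_
      have h1 := (Real.hasDerivAt_rpow_const (x := x) (p := e j) (Or.inl hx0.ne')).const_mul
        (-r * b j / e j)
      refine h1.congr_deriv ?_
      have := (hej j hj).ne
      field_simp
    have hzero : radialIntegral d r R - F R = 0 := by
      refine eq_of_hasDerivAt_zero_of_tendsto (f := fun x => radialIntegral d r x - F x)
        (fun x hx => ?_) ?_ hR
      · refine ((hasDerivAt_radialIntegral (d := d) hr0.le hx).sub (hFd x hx)).congr_deriv ?_
        rw [← hc x hx, show r + 1 = p - m by rw [hr]; ring]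
        ring
      · simpa using (tendsto_radialIntegral_zero d hr0).sub hFt
    exact sub_eq_zero.1 hzero

theorem exists_polynomial_goncharA (hd : 1 ≤ d) (hs : 0 < s) (m : ℕ) (hsm : s = (d : ℝ) - 1 - 2 * m)
    (q : ℝ) : ∃ P : Polynomial ℝ, ∀ R : ℝ, 1 < R → goncharA d s q R = P.eval R := by
  obtain ⟨c, hc⟩ := exists_radialIntegral_eq_sum hd m (by linarith)
  have hU : ∀ R : ℝ, 1 < R → R ^ (d - 1) * sigmaPotential d s R =
      ∑ j ∈ Finset.range (m + 1), c j * R ^ (2 * j) := by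
    intro R hR
    have h0 : 0 < R := by linarith
    rw [sigmaPotential_eq_integral d s hR, integral_norm_sub_source_rpow d s hR,
      show s / 2 = ((d : ℝ) - 1) / 2 - m by rw [hsm]; ring, hc R hR, ← Real.rpow_natCast,
      Nat.cast_sub hd, ← mul_assoc, ← Real.rpow_add h0, Finset.mul_sum]
    refine Finset.sum_congr rfl fun j _ => ?_
    rw [mul_left_comm, ← Real.rpow_add h0, ← Real.rpow_natCast]
    congr 2
    push_cast
    ring
  have hpow : ∀ R : ℝ, (R + 1) ^ ((d : ℝ) - s) = (R + 1) ^ (2 * m + 1) := fun R => by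
    rw [← Real.rpow_natCast]
    congr 1
    rw [hsm]
    push_cast
    ring
  refine ⟨(Polynomial.C ((sphereEnergy d s).toReal / q) * (Polynomial.X - 1) ^ d -
    (Polynomial.X + 1) ^ (2 * m + 1)) * Polynomial.X ^ (d - 1) + (Polynomial.X - 1) ^ d *
      ∑ j ∈ Finset.range (m + 1), Polynomial.C (c j) * Polynomial.X ^ (2 * j), fun R hR => ?_⟩
  rw [goncharA, hpow, mul_right_comm, hU R hR]
  simp [Polynomial.eval_finsetSum]
  ring

end Polynomial

end Gonchar

end

theorem mainTheorem3 (d : ℕ) (s q : ℝ) (hs : 0 < s) (hsd : s < d) (hq : 0 < q) :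
    (∀ R : ℝ, 1 < R → ∃! η : MeasureTheory.SignedMeasure (Gonchar.Sph d),
      Gonchar.IsSignedEquilibrium s (Gonchar.externalField d R q s) η) ∧
    (∃ Rq : ℝ, 1 < Rq ∧ (∀ R : ℝ, 1 < R → (Gonchar.goncharA d s q R = 0 ↔ R = Rq)) ∧
      (∀ R : ℝ, 1 < R → ∀ η : MeasureTheory.SignedMeasure (Gonchar.Sph d),
        Gonchar.IsSignedEquilibrium s (Gonchar.externalField d R q s) η →
          (0 ≤ η ↔ Rq ≤ R) ∧
          (Rq ≤ R → ∀ V : Set (Gonchar.Sph d), IsOpen V → V.Nonempty → 0 < η V)) ∧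
      IsLeast (Gonchar.fullSupportDistances d s q) (Rq - 1)) ∧
    (∀ m : ℕ, s = (d : ℝ) - 1 - 2 * m →
      ∃ P : Polynomial ℝ, ∀ R : ℝ, 1 < R → Gonchar.goncharA d s q R = P.eval R) := by
  have hd : 1 ≤ d := by
    have : (0 : ℝ) < d := hs.trans hsd
    exact_mod_cast this
  refine ⟨fun R hR => ?_, ?_, fun m hm => Gonchar.exists_polynomial_goncharA hd hs m hm q⟩
  · obtain ⟨η, hη⟩ := Gonchar.exists_isSignedEquilibrium hR hs hsd hq
    exact ⟨η, hη, fun η' hη' => hη'.eq hs hsd hη⟩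
  · obtain ⟨Rq, hRq, h⟩ := Gonchar.exists_goncharA_zero hs hsd hq
    refine ⟨Rq, hRq, fun R hR => (h R hR).1, fun R hR η hη => ⟨?_, fun hle V hV hne => ?_⟩, ?_, ?_⟩
    · rw [hη.nonneg_iff hR hs hsd hq, (h R hR).2]
    · exact hη.pos_of_isOpen hR hs hsd hq ((h R hR).2.2 hle) hV hne
    · exact (Gonchar.mem_fullSupportDistances_iff hs hsd hq).2
        ⟨Rq, hRq, rfl, (h Rq hRq).2.2 le_rfl⟩
    · intro ρ hρ
      obtain ⟨R, hR, rfl, hΓ⟩ := (Gonchar.mem_fullSupportDistances_iff hs hsd hq).1 hρ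
      linarith [(h R hR).2.1 hΓ]
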